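/- For real numbers $d\ge 1$ and $\lambda$ with $|\lambda|\le\sqrt d$, and $n \ge 2d$, let $\mathrm{SBM}(n,d,\lambda)$ be the law of the random graph $\mathbf G$ on $[n]$ obtained as follows: draw $\boldsymbol\sigma\in\{\pm1\}^n$ uniformly at random and, given $\boldsymbol\sigma$, join each pair of distinct vertices $u,v$ independently with probability $\frac{d+\lambda\sqrt d}{n}$ if $\boldsymbol\sigma(u)=\boldsymbol\sigma(v)$ and $\frac{d-\lambda\sqrt d}{n}$ otherwise. For a graph $H$, let $V'(H)$ be its set of non-isolated vertices. The tree-excess of a connected graph $(V,E)$ is $|E|-|V|+1$, and $H$ is a near-forest if each of its connected components has tree-excess at most $1$. For $S\subseteq V(H)$, the graph $H$ is $(\Delta,D)$-pseudorandom with respect to $S$ if (i) for all integers $r\ge 1$ and all $u\in V(H)$, $|\{v\in V(H):\mathrm{dist}_H(u,v)\le r\}|\le D^{r-1}\Delta$, and (ii) for all integers $r\ge 0$ and all $u\in V(H)$, $|\{v\in S:\mathrm{dist}_H(u,v)\le r\}|\le D^r$. **Theorem.** There are universal constants $C_1,C_2>0$ such that for all fixed real $d\ge1$, $\lambda$ with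 $|\lambda|\le\sqrt d$, and $$\varepsilon\ \ge\ C_1\left(\frac{C_2+\log d}{d}\right)^{1/3},$$ there is a function $\Delta=\Delta(n)$ with $\Delta(n)=o(\log n)$ as $n\to\infty$ such that, with probability tending to $1$ as $n\to\infty$, the edge set of $\mathbf G\sim\mathrm{SBM}(n,d,\lambda)$ can be partitioned as $E(\mathbf G)=E(\mathbf G_1)\sqcup E(\mathbf G_2)$ for graphs $\mathbf G_1,\mathbf G_2$ on $[n]$ such that: 1. the maximum degree of $\mathbf G_1$ is at most $(1+\varepsilon)d$; 2. $\mathbf G_2$ is a near-forest and is $(\Delta(n),D)$-pseudorandom with respect to $S=V'(\mathbf G_1)\cap V'(\mathbf G_2)$, where $D=(1+\varepsilon)d$. -/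

import Mathlib

open MeasureTheory ProbabilityTheory Filter Asymptotics
open scoped Topology ENNReal

/-- The tree-excess `|E| - |V| + 1` of a (finite connected) graph, as an integer. -/
noncomputable def SimpleGraph.treeExcess {V : Type*} (G : SimpleGraph V) : ℤ :=
  (Nat.card G.edgeSet : ℤ) - (Nat.card V : ℤ) + 1

/-- A near-forest: every connected component has tree-excess at most one. -/
def SimpleGraph.IsNearForest {V : Type*} (H : SimpleGraph V) : Prop :=
  ∀ C : H.ConnectedComponent, C.toSimpleGraph.treeExcess ≤ 1

/-- The closed `r`-ball around `u` in the graph metric of `H`; vertices in other components are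
at distance `⊤` and hence never in the ball. -/
def SimpleGraph.distBall {V : Type*} (H : SimpleGraph V) (u : V) (r : ℕ) : Set V :=
  {v | H.edist u v ≤ (r : ℕ∞)}

/-- `H` is `(Δ, D)`-pseudorandom with respect to the set of vertices `S`. -/
structure SimpleGraph.IsPseudorandom {V : Type*} (H : SimpleGraph V) (Δ D : ℝ) (S : Set V) :
    Prop where
  ball_le : ∀ r : ℕ, 1 ≤ r → ∀ u : V, ((H.distBall u r).ncard : ℝ) ≤ D ^ (r - 1) * Δ
  ball_inter_le : ∀ (r : ℕ) (u : V), ((S ∩ H.distBall u r).ncard : ℝ) ≤ D ^ r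

/-- Given the community assignment `σ`, the probability that the pair `e` is an edge:
`(d + lam √d) / n` inside a community and `(d - lam √d) / n` across communities. The projection to
`[0, 1]` changes nothing when `|lam| ≤ √d` and `2 d ≤ n`. -/
noncomputable def sbmEdgeProb (n : ℕ) (d lam : ℝ) (σ : Fin n → ℤˣ) (e : Sym2 (Fin n)) :
    unitInterval :=
  Sym2.lift ⟨fun u v => Set.projIcc (0 : ℝ) 1 zero_le_one
    (if σ u = σ v then (d + lam * √d) / n else (d - lam * √d) / n),
    fun u v => by simp only [eq_comm (a := σ u)]⟩ e

/-- The stochastic block model conditioned on the community assignment `σ`: independent edges with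
probabilities `sbmEdgeProb` (the coins of the diagonal pairs are discarded by `fromEdgeSet`). -/
noncomputable def sbmGiven (n : ℕ) (d lam : ℝ) (σ : Fin n → ℤˣ) :
    Measure (SimpleGraph (Fin n)) :=
  (Measure.pi fun e : Sym2 (Fin n) =>
    bernoulliMeasure True False (sbmEdgeProb n d lam σ e)).map
      fun ω => SimpleGraph.fromEdgeSet {e | ω e}

/-- The two-community stochastic block model `SBM(n, d, lam)`: the community assignment
`σ ∈ {±1}ⁿ` is uniform, and given `σ` the graph has law `sbmGiven`. -/
noncomputable def sbm (n : ℕ) (d lam : ℝ) : Measure (SimpleGraph (Fin n)) :=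
  ((2 : ℝ≥0∞) ^ n)⁻¹ • ∑ σ : Fin n → ℤˣ, sbmGiven n d lam σ

instance sbmGiven.isProbabilityMeasure (n : ℕ) (d lam : ℝ) (σ : Fin n → ℤˣ) :
    IsProbabilityMeasure (sbmGiven n d lam σ) :=
  Measure.isProbabilityMeasure_map (measurable_of_finite _).aemeasurable

instance sbm.isProbabilityMeasure (n : ℕ) (d lam : ℝ) : IsProbabilityMeasure (sbm n d lam) := by
  constructor
  simp only [sbm, Measure.smul_apply, Measure.finsetSum_apply, measure_univ, smul_eq_mul,
    Finset.sum_const, Finset.card_univ, nsmul_eq_mul, mul_one]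
  have h : (Fintype.card (Fin n → ℤˣ) : ℝ≥0∞) = 2 ^ n := by simp
  rw [h]
  exact ENNReal.inv_mul_cancel (by simp) (by simp)

/-! ### Balls, closed neighbourhoods and expanding cores -/

namespace SimpleGraph

variable {V : Type*}

/-! Call a ball of radius `r` large if it has more than `D ^ r` vertices, let `W` be the union of
the large balls, and let `G₂` consist of the edges meeting `W`. The degree bound and the second
pseudorandomness condition are then automatic: a vertex outside `W` has no large ball of radius 1,
and vertices of `W` are isolated in `G₁`, so a large ball misses `S`.

The main point is that components of `G₂` have diameter below `L ≈ K log n` (`edist_touching_lt`). A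
large ball has grown on average faster than `D`, so it contains a connected core expanding by a
factor `D₁ < D` (`exists_expanding_core`). Along a geodesic of length at least `L` in `G₂`, Vitali's
lemma selects disjoint large balls whose radii sum to a constant fraction of the length. Geodesic,
links to the centres and cores form a connected set `A`, of which the union `A'` of the cores is a
proportion at least `1 / T`, and `A'` expands by `D₁`.

A first moment over connected sets excludes this. The expected number of connected `k`-sets through
a given vertex is at most `(4q)^k / (2q)` (`sum_pow_mul_le_of_split`), and the edges leaving `A` are
independent of its connectedness, so Chernoff applies. With `x = ε d`, the gain per vertex of `A` is
of order `x³ / (d + x)²` and has to beat `log d`; this is the origin of the exponent `1/3`.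

A component of `G₂` with tree-excess at least 2 would contain a connected set of at most `4L`
vertices with two redundant edges. Each such edge costs a factor of order `1/n`, and `K` is small
enough for the count of sets to be about `n^(3/2)`. For the first condition, balls stay below `δ log
n` for any fixed number of steps, for every fixed `δ > 0`; a diagonal choice of `δ` gives `Δ = o(log
n)`. All estimates are uniform over independent-edge models with expected degrees at most `d + 1`,
which covers the block model given balanced labels. -/

theorem edist_le_coe_iff {G : SimpleGraph V} {u v : V} {r : ℕ} :
    G.edist u v ≤ r ↔ ∃ p : G.Walk u v, p.length ≤ r := by
  constructor
  · intro h
    obtain ⟨p, hp⟩ := exists_walk_of_edist_ne_top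
      (ne_top_of_le_ne_top (ENat.natCast_ne_top r) h)
    exact ⟨p, by rw [← hp] at h; exact_mod_cast h⟩
  · rintro ⟨p, hp⟩
    exact (edist_le p).trans (by exact_mod_cast hp)

/-- The vertices of a walk form a connected set. -/
theorem Walk.connected_induce_toFinset [DecidableEq V] {G : SimpleGraph V} {u v : V}
    (p : G.Walk u v) : (G.induce (p.support.toFinset : Set V)).Connected := by
  have h := p.connected_induce_support
  have e : ({v | v ∈ p.support} : Set V) = (p.support.toFinset : Set V) := by ext; simp
  rwa [e] at h

theorem connected_induce_mono {G H : SimpleGraph V} (h : G ≤ H) {A : Set V}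
    (hA : (G.induce A).Connected) : (H.induce A).Connected :=
  hA.mono (fun _ _ hxy => h hxy)

variable [Fintype V]

open Classical in
/-- The closed ball of the graph metric, as a finset. -/
noncomputable def ballFinset (G : SimpleGraph V) (u : V) (r : ℕ) : Finset V :=
  Finset.univ.filter fun v => G.edist u v ≤ r

open Classical in
/-- The closed neighbourhood of a set of vertices. -/
noncomputable def closedNbhd (G : SimpleGraph V) (A : Finset V) : Finset V :=
  Finset.univ.filter fun v => v ∈ A ∨ ∃ x ∈ A, G.Adj x v

variable {G : SimpleGraph V} {u v : V} {r : ℕ}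

theorem mem_ballFinset : v ∈ G.ballFinset u r ↔ G.edist u v ≤ r := by
  simp [ballFinset]

theorem mem_closedNbhd {A : Finset V} :
    v ∈ G.closedNbhd A ↔ v ∈ A ∨ ∃ x ∈ A, G.Adj x v := by
  simp [closedNbhd]

theorem closedNbhd_mono {A B : Finset V} (h : A ⊆ B) : G.closedNbhd A ⊆ G.closedNbhd B := by
  intro v hv
  rw [mem_closedNbhd] at hv ⊢
  rcases hv with hv | ⟨x, hx, hxv⟩
  · exact Or.inl (h hv)
  · exact Or.inr ⟨x, h hx, hxv⟩

theorem coe_ballFinset : (G.ballFinset u r : Set V) = G.distBall u r := by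
  ext v
  simp [mem_ballFinset, distBall]

theorem self_mem_ballFinset : u ∈ G.ballFinset u r := by
  simp [mem_ballFinset]

theorem ballFinset_mono {s : ℕ} (h : r ≤ s) : G.ballFinset u r ⊆ G.ballFinset u s := by
  intro v hv
  rw [mem_ballFinset] at hv ⊢
  exact hv.trans (by exact_mod_cast h)

theorem ballFinset_zero : G.ballFinset u 0 = {u} := by
  ext v
  simp only [mem_ballFinset, Nat.cast_zero, nonpos_iff_eq_zero, edist_eq_zero_iff,
    Finset.mem_singleton]
  exact eq_comm

theorem closedNbhd_ballFinset : G.closedNbhd (G.ballFinset u r) = G.ballFinset u (r + 1) := by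
  ext v
  simp only [mem_closedNbhd, mem_ballFinset]
  constructor
  · rintro (h | ⟨x, hx, hxv⟩)
    · exact h.trans (by exact_mod_cast Nat.le_succ r)
    · obtain ⟨p, hp⟩ := edist_le_coe_iff.1 hx
      exact edist_le_coe_iff.2 ⟨p.concat hxv, by simpa using hp⟩
  · intro h
    obtain ⟨p, hp⟩ := edist_le_coe_iff.1 h
    rcases Nat.lt_or_ge r p.length with hr | hr
    · right
      have hnil : ¬ p.Nil := by
        intro hn
        have := Walk.length_eq_zero_iff.2 hn
        omega
      refine ⟨p.penultimate, edist_le_coe_iff.2 ⟨p.dropLast, ?_⟩, p.adj_penultimate hnil⟩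
      have := congrArg Walk.length (p.concat_dropLast (p.adj_penultimate hnil))
      simp only [Walk.length_concat] at this
      omega
    · exact Or.inl (edist_le_coe_iff.2 ⟨p, hr⟩)

theorem Walk.mem_ballFinset_of_mem_support {w x : V} (p : G.Walk u w) (hp : p.length ≤ r)
    (hx : x ∈ p.support) : x ∈ G.ballFinset u r := by
  classical
  exact mem_ballFinset.2 (edist_le_coe_iff.2
    ⟨p.takeUntil x hx, (p.length_takeUntil_le_length hx).trans hp⟩)

theorem connected_induce_ballFinset : (G.induce (G.ballFinset u r : Set V)).Connected := by
  refine G.induce_connected_of_patches u (Finset.mem_coe.2 self_mem_ballFinset) ?_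
  intro v hv
  obtain ⟨p, hp⟩ := edist_le_coe_iff.1 (mem_ballFinset.1 (Finset.mem_coe.1 hv))
  exact ⟨{x | x ∈ p.support}, fun x hx => p.mem_ballFinset_of_mem_support hp hx, by simp, by simp,
    p.connected_induce_support _ _⟩

/-- A ball that has exhausted its component is also a ball of smaller radius. Passing to an attained
radius provides the geodesic needed to build a core. -/
theorem exists_edist_eq_of_ballFinset (G : SimpleGraph V) (u : V) (r : ℕ) :
    ∃ s ≤ r, G.ballFinset u s = G.ballFinset u r ∧ ∃ w, G.edist u w = s := by
  induction r with
  | zero => exact ⟨0, le_rfl, rfl, u, by simp⟩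
  | succ k ih =>
    by_cases h : ∃ w, G.edist u w = ((k + 1 : ℕ) : ℕ∞)
    · exact ⟨k + 1, le_rfl, rfl, h⟩
    · obtain ⟨s, hs, hsk, hw⟩ := ih
      refine ⟨s, by omega, hsk.trans ((ballFinset_mono (Nat.le_succ k)).antisymm ?_), hw⟩
      intro v hv
      rw [mem_ballFinset] at hv ⊢
      push Not at h
      have hlt := lt_of_le_of_ne hv (h v)
      exact Order.le_of_lt_add_one (by simpa using hlt)

/-- A ball that outgrows `D ^ r` contains a connected set of size proportional to `r` whose closed
neighbourhood, still inside the ball, is larger by a factor `D₁`. -/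
theorem exists_expanding_core {D D₁ θ : ℝ} (hD₁ : 2 ≤ D₁) (hθ : 0 ≤ θ) (hθ1 : θ < 1)
    (hD : D₁ * Real.exp (2 * θ) ≤ D) (hbad : D ^ r < (G.ballFinset u r).card)
    (hw : ∃ w, G.edist u w = r) :
    ∃ A : Finset V, u ∈ A ∧ (G.induce (A : Set V)).Connected ∧
      G.closedNbhd A ⊆ G.ballFinset u r ∧ θ * r ≤ A.card ∧
      D₁ * A.card ≤ (G.closedNbhd A).card := by
  classical
  set m : ℕ := ⌊θ * r⌋₊ with hm
  have hmle : (m : ℝ) ≤ θ * r := Nat.floor_le (by positivity)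
  have hmlt : θ * r < m + 1 := Nat.lt_floor_add_one _
  -- some ball expands even after adding `m` vertices
  obtain ⟨i, hir, hi⟩ : ∃ i < r,
      D₁ * ((G.ballFinset u i).card + m) ≤ (G.ballFinset u (i + 1)).card := by
    by_contra hcon
    push Not at hcon
    -- The shift by `2 * m` makes the recursion purely multiplicative, because `2 * m ≤ D₁ * m`.
    have key : ∀ i ≤ r, ((G.ballFinset u i).card : ℝ) + 2 * m ≤ D₁ ^ i * (1 + 2 * m) := by
      intro i hi
      induction i with
      | zero => simp [ballFinset_zero]
      | succ k ih =>
        have h1 := hcon k (by omega)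
        have h2 := ih (by omega)
        have hm0 : (0 : ℝ) ≤ m := by positivity
        have h3 := mul_le_mul_of_nonneg_left h2 (by linarith : 0 ≤ D₁)
        rw [pow_succ]
        nlinarith
    have h1 := key r le_rfl
    have h2 : (1 + 2 * (m : ℝ)) ≤ Real.exp (2 * θ) ^ r := by
      rw [← Real.exp_nat_mul]
      have := Real.add_one_le_exp ((r : ℝ) * (2 * θ))
      linarith
    have h3 : D₁ ^ r * (1 + 2 * (m : ℝ)) ≤ D ^ r := by
      calc D₁ ^ r * (1 + 2 * (m : ℝ)) ≤ D₁ ^ r * Real.exp (2 * θ) ^ r := by gcongr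
        _ = (D₁ * Real.exp (2 * θ)) ^ r := by rw [mul_pow]
        _ ≤ D ^ r := by gcongr
    have : (0 : ℝ) ≤ m := by positivity
    linarith
  have hmr : m ≤ r - 1 := by
    have : (m : ℝ) < r := by
      have : (0 : ℝ) < r := by exact_mod_cast (by omega : 0 < r)
      nlinarith
    have : m < r := by exact_mod_cast this
    omega
  obtain ⟨w, hw⟩ := hw
  obtain ⟨p, hp⟩ := exists_walk_of_edist_eq_coe hw
  have hpath : p.IsPath := p.isPath_of_length_eq_dist (by rw [hp, dist, hw]; simp)
  have hqpath : (p.take m).IsPath := hpath.take m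
  have hqlen : (p.take m).length = m := by
    rw [Walk.take_length]; omega
  have hqcard : (p.take m).support.toFinset.card = m + 1 := by
    rw [List.toFinset_card_of_nodup hqpath.support_nodup, Walk.length_support, hqlen]
  -- The ball supplies the expansion and the initial segment of a geodesic the size `θ * r`. Since
  -- `i` and `m` are at most `r - 1`, the closed neighbourhood stays in the ball of radius `r`.
  set A : Finset V := G.ballFinset u i ∪ (p.take m).support.toFinset with hA
  have huA : u ∈ G.ballFinset u i ∩ (p.take m).support.toFinset := by
    simp [self_mem_ballFinset]
  have hAsub : A ⊆ G.ballFinset u (r - 1) := by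
    refine Finset.union_subset (ballFinset_mono (by omega)) ?_
    intro x hx
    exact (p.take m).mem_ballFinset_of_mem_support (by omega) (List.mem_toFinset.1 hx)
  have hAcard : A.card ≤ (G.ballFinset u i).card + m := by
    have h1 := Finset.card_union_add_card_inter (G.ballFinset u i) (p.take m).support.toFinset
    have h2 := Finset.card_pos.2 ⟨u, huA⟩
    rw [← hA] at h1
    omega
  refine ⟨A, Finset.mem_union_left _ self_mem_ballFinset, ?_, ?_, ?_, ?_⟩
  · rw [hA, Finset.coe_union]
    refine induce_union_connected connected_induce_ballFinset.preconnected
      (p.take m).connected_induce_toFinset.preconnected ⟨u, ?_⟩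
    exact_mod_cast huA
  · have := closedNbhd_mono (G := G) hAsub
    rwa [closedNbhd_ballFinset, Nat.sub_add_cancel (by omega)] at this
  · have : m + 1 ≤ A.card := by
      rw [← hqcard]; exact Finset.card_le_card Finset.subset_union_right
    have : ((m : ℝ) + 1) ≤ A.card := by exact_mod_cast this
    linarith
  · have h1 : G.ballFinset u (i + 1) ⊆ G.closedNbhd A := by
      rw [← closedNbhd_ballFinset]; exact closedNbhd_mono Finset.subset_union_left
    have h2 : ((G.ballFinset u (i + 1)).card : ℝ) ≤ (G.closedNbhd A).card := by
      exact_mod_cast Finset.card_le_card h1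
    have h3 : (A.card : ℝ) ≤ (G.ballFinset u i).card + m := by exact_mod_cast hAcard
    have := mul_le_mul_of_nonneg_left h3 (by linarith : 0 ≤ D₁)
    linarith

end SimpleGraph

/-! ### Edges touching large balls, and the diameter of their components -/

namespace SimpleGraph

variable {V : Type*}

/-- The edges of `G` with an endpoint in `W`. -/
def touching (G : SimpleGraph V) (W : Set V) : SimpleGraph V where
  Adj u v := G.Adj u v ∧ (u ∈ W ∨ v ∈ W)
  symm := ⟨fun _ _ h => ⟨h.1.symm, h.2.symm⟩⟩
  loopless := ⟨fun _ h => h.1.ne rfl⟩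

/-- The edges of `G` with no endpoint in `W`. -/
def avoiding (G : SimpleGraph V) (W : Set V) : SimpleGraph V where
  Adj u v := G.Adj u v ∧ u ∉ W ∧ v ∉ W
  symm := ⟨fun _ _ h => ⟨h.1.symm, h.2.2, h.2.1⟩⟩
  loopless := ⟨fun _ h => h.1.ne rfl⟩

theorem touching_le (G : SimpleGraph V) (W : Set V) : G.touching W ≤ G := fun _ _ h => h.1

/-- Otherwise a shortcut between the two vertices would shorten the geodesic `p`. -/
theorem Walk.le_add_of_edist_getVert_le {H : SimpleGraph V} {a b : V} (p : H.Walk a b)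
    (hp : (p.length : ℕ∞) = H.edist a b) {j k m : ℕ} (hj : j ≤ p.length)
    (h : H.edist (p.getVert k) (p.getVert j) ≤ m) : j ≤ k + m := by
  have h1 : H.edist a (p.getVert k) ≤ k :=
    edist_le_coe_iff.2 ⟨p.take k, by rw [Walk.take_length]; exact min_le_left _ _⟩
  have h2 : H.edist (p.getVert j) b ≤ ((p.length - j : ℕ) : ℕ∞) :=
    edist_le_coe_iff.2 ⟨p.drop j, by rw [Walk.drop_length]⟩
  have h3 : (p.length : ℕ∞) ≤ ((k + m + (p.length - j) : ℕ) : ℕ∞) := by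
    rw [hp]
    calc H.edist a b ≤ H.edist a (p.getVert j) + H.edist (p.getVert j) b := H.edist_triangle
      _ ≤ (H.edist a (p.getVert k) + H.edist (p.getVert k) (p.getVert j)) +
          H.edist (p.getVert j) b := by gcongr; exact H.edist_triangle
      _ ≤ _ := by
        have := add_le_add (add_le_add h1 h) h2
        exact_mod_cast this
  have h4 : p.length ≤ k + m + (p.length - j) := by exact_mod_cast h3
  omega

variable [Fintype V]

/-- The union of all balls that outgrow `D ^ r`. -/
def largeBallCover (G : SimpleGraph V) (D : ℝ) : Set V :=
  {w | ∃ u r, D ^ r < (G.ballFinset u r).card ∧ w ∈ G.ballFinset u r}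

variable {G : SimpleGraph V} {u v : V} {r : ℕ} {D : ℝ}

/-- A shortest walk from the centre stays in the large ball, hence in the cover, so it loses no
edge. -/
theorem edist_touching_le (h : D ^ r < (G.ballFinset u r).card) (hv : v ∈ G.ballFinset u r) :
    (G.touching (G.largeBallCover D)).edist u v ≤ r := by
  obtain ⟨p, hp⟩ := edist_le_coe_iff.1 (mem_ballFinset.1 hv)
  refine edist_le_coe_iff.2 ⟨p.transfer _ ?_, by rwa [Walk.length_transfer]⟩
  intro e he
  induction e with
  | h x y =>
    exact ⟨p.adj_of_mem_edges he, Or.inl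
      ⟨u, r, h, p.mem_ballFinset_of_mem_support hp (p.fst_mem_support_of_mem_edges he)⟩⟩

/-- Lowering the radius to an attained one keeps the ball large because `1 ≤ D`. The extra step in
`r + 1` is for the case where only the neighbour of `x` is covered. -/
theorem exists_large_ball_near (hD : 1 ≤ D) {x : V}
    (hx : ∃ y, (G.touching (G.largeBallCover D)).Adj x y) :
    ∃ u r, 1 ≤ r ∧ D ^ r < (G.ballFinset u r).card ∧ (∃ w, G.edist u w = r) ∧
      (G.touching (G.largeBallCover D)).edist x u ≤ ((r + 1 : ℕ) : ℕ∞) := by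
  set H := G.touching (G.largeBallCover D) with hH
  obtain ⟨y, hy⟩ := hx
  obtain ⟨z, hzW, hz⟩ : ∃ z ∈ G.largeBallCover D, H.edist x z ≤ 1 := by
    rcases hy.2 with h | h
    · exact ⟨x, h, by simp⟩
    · exact ⟨y, h, (edist_eq_one_iff_adj.2 hy).le⟩
  obtain ⟨u, r, hr, hzr⟩ := hzW
  obtain ⟨s, hsr, hs, hw⟩ := G.exists_edist_eq_of_ballFinset u r
  have hbad : D ^ s < (G.ballFinset u s).card := by
    rw [hs]; exact (pow_le_pow_right₀ hD hsr).trans_lt hr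
  have hs1 : 1 ≤ s := by
    rcases Nat.eq_zero_or_pos s with rfl | h
    · simp [ballFinset_zero] at hbad
    · exact h
  refine ⟨u, s, hs1, hbad, hw, ?_⟩
  have h1 := edist_touching_le hbad (hs ▸ hzr)
  calc H.edist x u ≤ H.edist x z + H.edist z u := H.edist_triangle
    _ ≤ 1 + s := add_le_add hz (by rw [edist_comm]; exact h1)
    _ = ((s + 1 : ℕ) : ℕ∞) := by push_cast; ring

theorem closedNbhd_biUnion [DecidableEq V] {ι : Type*} (I : Finset ι) (f : ι → Finset V) :
    G.closedNbhd (I.biUnion f) = I.biUnion fun i => G.closedNbhd (f i) := by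
  ext v
  simp only [mem_closedNbhd, Finset.mem_biUnion]
  grind

/-- If large connected sets contain no dense expanding part, then the graph of edges touching the
large balls has only components of small diameter. -/
theorem edist_touching_lt {D₁ θ T : ℝ} {L : ℕ} (hD1 : 1 ≤ D) (hD₁ : 2 ≤ D₁) (hθ : 0 < θ)
    (hθ1 : θ < 1) (hD : D₁ * Real.exp (2 * θ) ≤ D) (hT : 21 ≤ θ * T) (hL : 1 ≤ L)
    (hexp : ∀ A A' : Finset V, (G.induce (A : Set V)).Connected → A' ⊆ A → L ≤ A.card →
      (A.card : ℝ) ≤ T * A'.card → ((G.closedNbhd A').card : ℝ) < D₁ * A'.card)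
    {a b : V} (hab : (G.touching (G.largeBallCover D)).Reachable a b) :
    (G.touching (G.largeBallCover D)).edist a b < L := by
  classical
  set H := G.touching (G.largeBallCover D) with hH
  by_contra hcon
  push Not at hcon
  obtain ⟨p, hp⟩ := hab.exists_walk_length_eq_edist
  rw [← hp] at hcon
  have hpL : L ≤ p.length := by exact_mod_cast hcon
  have hpath : p.IsPath := p.isPath_of_length_eq_dist (by rw [dist, ← hp]; simp)
  have hadj : ∀ k, k ≤ p.length → ∃ y, H.Adj (p.getVert k) y := by
    intro k hk
    rcases Nat.lt_or_ge k p.length with h | h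
    · exact ⟨_, p.adj_getVert_succ h⟩
    · have := p.adj_getVert_succ (i := k - 1) (by omega)
      rw [Nat.sub_add_cancel (by omega)] at this
      exact ⟨_, this.symm⟩
  have hnear : ∀ k : ℕ, ∃ (u : V) (r : ℕ), k ≤ p.length → (1 ≤ r ∧
      D ^ r < (G.ballFinset u r).card ∧ (∃ w, G.edist u w = r) ∧
      H.edist (p.getVert k) u ≤ ((r + 1 : ℕ) : ℕ∞)) := by
    intro k
    by_cases hk : k ≤ p.length
    · obtain ⟨u, r, h⟩ := exists_large_ball_near hD1 (hadj k hk)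
      exact ⟨u, r, fun _ => h⟩
    · exact ⟨a, 0, fun h => absurd h hk⟩
  choose c ρ hcρ using hnear
  set t : Finset ℕ := Finset.range (p.length + 1) with ht
  have hmem : ∀ {k}, k ∈ t ↔ k ≤ p.length := by
    intro k; rw [ht, Finset.mem_range]; omega
  -- The selection is made among balls of `G`, which contain the closed neighbourhoods of the cores,
  -- so these will be disjoint too. Each ball meets a selected one of at least half its radius.
  obtain ⟨I, hIt, hIdisj, hIcov⟩ := Vitali.exists_disjoint_subfamily_covering_enlargement
    (fun k => (G.ballFinset (c k) (ρ k) : Set V)) (t : Set ℕ) (fun k => (ρ k : ℝ)) 2 (by norm_num)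
    (fun k _ => by positivity) (((t.sup ρ : ℕ)) : ℝ)
    (fun k hk => by exact_mod_cast Finset.le_sup (f := ρ) hk)
    (fun k _ => ⟨c k, Finset.mem_coe.2 self_mem_ballFinset⟩)
  lift I to Finset ℕ using (t.finite_toSet.subset hIt)
  have hIp : ∀ i ∈ I, i ≤ p.length := fun i hi => hmem.1 (hIt hi)
  -- the chosen balls control the length of the walk
  have hcover : t ⊆ I.biUnion fun i => Finset.Icc (i - 8 * ρ i) (i + 8 * ρ i) := by
    intro k hk
    obtain ⟨i, hi, ⟨z, hzk, hzi⟩, hki⟩ := hIcov k hk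
    obtain ⟨hk1, hkbad, -, hkd⟩ := hcρ k (hmem.1 hk)
    obtain ⟨hi1, hibad, -, hid⟩ := hcρ i (hIp i hi)
    have hki' : ρ k ≤ 2 * ρ i := by exact_mod_cast hki
    have e1 : H.edist (c k) z ≤ ρ k := edist_touching_le hkbad hzk
    have e2 : H.edist (c i) z ≤ ρ i := edist_touching_le hibad hzi
    -- The detour through both centres has length at most `2 ρ k + 2 ρ i + 2`, and `ρ k ≤ 2 ρ i`, `1
    -- ≤ ρ i` bound it by `8 ρ i`.
    have hdist : H.edist (p.getVert k) (p.getVert i) ≤ ((8 * ρ i : ℕ) : ℕ∞) := by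
      calc H.edist (p.getVert k) (p.getVert i)
          ≤ H.edist (p.getVert k) z + H.edist z (p.getVert i) := H.edist_triangle
        _ ≤ (H.edist (p.getVert k) (c k) + H.edist (c k) z) +
            (H.edist z (c i) + H.edist (c i) (p.getVert i)) :=
          add_le_add H.edist_triangle H.edist_triangle
        _ ≤ ((ρ k + 1 : ℕ) + ρ k) + (ρ i + (ρ i + 1 : ℕ)) := by
          refine add_le_add (add_le_add hkd e1) (add_le_add ?_ ?_)
          · rw [edist_comm]; exact e2
          · rw [edist_comm]; exact hid
        _ ≤ ((8 * ρ i : ℕ) : ℕ∞) := by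
          have : ((ρ k + 1) + ρ k) + (ρ i + (ρ i + 1)) ≤ 8 * ρ i := by omega
          exact_mod_cast this
    have h1 := p.le_add_of_edist_getVert_le hp (hIp i hi) hdist
    have h2 := p.le_add_of_edist_getVert_le hp (hmem.1 hk) (by rw [edist_comm]; exact hdist)
    rw [Finset.mem_biUnion]
    exact ⟨i, hi, by rw [Finset.mem_Icc]; omega⟩
  have hlen : p.length + 1 ≤ 17 * ∑ i ∈ I, ρ i := by
    calc p.length + 1 = t.card := by rw [ht, Finset.card_range]
      _ ≤ (I.biUnion fun i => Finset.Icc (i - 8 * ρ i) (i + 8 * ρ i)).card :=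
        Finset.card_le_card hcover
      _ ≤ ∑ i ∈ I, (Finset.Icc (i - 8 * ρ i) (i + 8 * ρ i)).card := Finset.card_biUnion_le
      _ ≤ ∑ i ∈ I, 17 * ρ i := by
        refine Finset.sum_le_sum fun i hi => ?_
        rw [Nat.card_Icc]
        have := (hcρ i (hIp i hi)).1
        omega
      _ = _ := by rw [Finset.mul_sum]
  have hcore : ∀ i : ℕ, ∃ A : Finset V, i ∈ I → (c i ∈ A ∧ (G.induce (A : Set V)).Connected ∧
      G.closedNbhd A ⊆ G.ballFinset (c i) (ρ i) ∧ θ * ρ i ≤ A.card ∧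
      D₁ * A.card ≤ (G.closedNbhd A).card) := by
    intro i
    by_cases hi : i ∈ I
    · obtain ⟨-, hbad, hw, -⟩ := hcρ i (hIp i hi)
      obtain ⟨A, hA⟩ := exists_expanding_core hD₁ hθ.le hθ1 hD hbad hw
      exact ⟨A, fun _ => hA⟩
    · exact ⟨∅, fun h => absurd h hi⟩
  choose K hK using hcore
  have hpathi : ∀ i : ℕ, ∃ q : Finset V, i ∈ I → (p.getVert i ∈ q ∧ c i ∈ q ∧
      (G.induce (q : Set V)).Connected ∧ q.card ≤ ρ i + 2) := by
    intro i
    by_cases hi : i ∈ I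
    · obtain ⟨q, hq⟩ := edist_le_coe_iff.1 (hcρ i (hIp i hi)).2.2.2
      refine ⟨q.support.toFinset, fun _ => ⟨by simp, by simp,
        connected_induce_mono (G.touching_le _) q.connected_induce_toFinset, ?_⟩⟩
      refine (List.toFinset_card_le _).trans ?_
      rw [Walk.length_support]
      omega
    · exact ⟨∅, fun h => absurd h hi⟩
  choose Q hQ using hpathi
  set P : Finset V := p.support.toFinset with hP
  have hPcard : P.card = p.length + 1 := by
    rw [hP, List.toFinset_card_of_nodup hpath.support_nodup, Walk.length_support]
  have hPconn : (G.induce (P : Set V)).Connected :=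
    connected_induce_mono (G.touching_le _) p.connected_induce_toFinset
  set A' : Finset V := I.biUnion K with hA'
  set A : Finset V := P ∪ I.biUnion fun i => Q i ∪ K i with hA
  have hPA : P ⊆ A := Finset.subset_union_left
  have haP : a ∈ P := by simp [hP]
  have hpiece : ∀ i ∈ I, (G.induce ((P ∪ (Q i ∪ K i) : Finset V) : Set V)).Connected := by
    intro i hi
    obtain ⟨h1, h2, h3, -⟩ := hQ i hi
    obtain ⟨h4, h5, -⟩ := hK i hi
    rw [Finset.coe_union, Finset.coe_union]
    refine induce_union_connected hPconn.preconnected (induce_union_connected h3.preconnected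
      h5.preconnected ⟨c i, h2, h4⟩).preconnected ⟨p.getVert i, ?_, Or.inl h1⟩
    simp [hP]
  have hAconn : (G.induce (A : Set V)).Connected := by
    refine G.induce_connected_of_patches a (hPA haP) ?_
    intro v hv
    rcases Finset.mem_union.1 (Finset.mem_coe.1 hv) with hv | hv
    · exact ⟨P, hPA, haP, hv, hPconn.preconnected _ _⟩
    · obtain ⟨i, hi, hvi⟩ := Finset.mem_biUnion.1 hv
      refine ⟨((P ∪ (Q i ∪ K i) : Finset V) : Set V), ?_, ?_, ?_, (hpiece i hi).preconnected _ _⟩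
      · exact_mod_cast Finset.union_subset_union_right
          (Finset.subset_biUnion_of_mem (fun i => Q i ∪ K i) hi)
      · exact Finset.mem_coe.2 (Finset.mem_union_left _ haP)
      · exact Finset.mem_coe.2 (Finset.mem_union_right _ hvi)
  have hA'A : A' ⊆ A := by
    refine (Finset.biUnion_mono fun i _ => ?_).trans Finset.subset_union_right
    exact Finset.subset_union_right
  have hsub : ∀ i ∈ I, K i ⊆ G.ballFinset (c i) (ρ i) := fun i hi x hx =>
    (hK i hi).2.2.1 (mem_closedNbhd.2 (Or.inl hx))
  have hballdisj : ∀ i ∈ I, ∀ j ∈ I, i ≠ j →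
      Disjoint (G.ballFinset (c i) (ρ i)) (G.ballFinset (c j) (ρ j)) := by
    intro i hi j hj hij
    exact Finset.disjoint_coe.1 (hIdisj hi hj hij)
  have hA'card : A'.card = ∑ i ∈ I, (K i).card :=
    Finset.card_biUnion fun i hi j hj hij =>
      (hballdisj i hi j hj hij).mono (hsub i hi) (hsub j hj)
  have hNcard : (G.closedNbhd A').card = ∑ i ∈ I, (G.closedNbhd (K i)).card := by
    rw [hA', closedNbhd_biUnion]
    exact Finset.card_biUnion fun i hi j hj hij =>
      (hballdisj i hi j hj hij).mono (hK i hi).2.2.1 (hK j hj).2.2.1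
  have hAcard : A.card ≤ 20 * ∑ i ∈ I, ρ i + A'.card := by
    have h1 : A.card ≤ P.card + ∑ i ∈ I, (Q i ∪ K i).card :=
      (Finset.card_union_le _ _).trans (Nat.add_le_add_left Finset.card_biUnion_le _)
    have h2 : ∑ i ∈ I, (Q i ∪ K i).card ≤ ∑ i ∈ I, (3 * ρ i + (K i).card) := by
      refine Finset.sum_le_sum fun i hi => (Finset.card_union_le _ _).trans ?_
      have := (hQ i hi).2.2.2
      have := (hcρ i (hIp i hi)).1
      omega
    rw [Finset.sum_add_distrib, ← Finset.mul_sum, ← hA'card] at h2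
    omega
  have hθsum : θ * ∑ i ∈ I, (ρ i : ℝ) ≤ A'.card := by
    rw [hA'card, Finset.mul_sum]
    push_cast
    exact Finset.sum_le_sum fun i hi => (hK i hi).2.2.2.1
  have hlarge : D₁ * A'.card ≤ (G.closedNbhd A').card := by
    rw [hA'card, hNcard]
    push_cast
    rw [Finset.mul_sum]
    exact Finset.sum_le_sum fun i hi => (hK i hi).2.2.2.2
  -- The constant 21 is 17 for the geodesic, 3 for the links to the centres, and 1 for the cores,
  -- using `θ < 1`.
  have hAT : (A.card : ℝ) ≤ T * A'.card := by
    have h1 : (A.card : ℝ) ≤ 20 * ∑ i ∈ I, (ρ i : ℝ) + A'.card := by exact_mod_cast hAcard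
    have h2 : θ * A.card ≤ θ * (T * A'.card) := by
      have h3 := mul_le_mul_of_nonneg_left h1 hθ.le
      have h4 : (0 : ℝ) ≤ A'.card := by positivity
      nlinarith
    exact le_of_mul_le_mul_left h2 hθ
  have hAL : L ≤ A.card := by
    have := Finset.card_le_card hPA
    omega
  exact absurd (hexp A A' hAconn hA'A hAL hAT) (not_lt.2 hlarge)

end SimpleGraph

/-! ### Near-forests and the deterministic decomposition -/

namespace SimpleGraph

variable {V : Type*}

/-- Following parents towards the root `a` sweeps out a small connected set. -/
theorem exists_connected_of_parent [DecidableEq V] {H K : SimpleGraph V} {a : V} (par : V → V)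
    (hpar : ∀ v, H.Reachable a v → v ≠ a → H.Reachable a (par v) ∧
      H.dist a (par v) + 1 = H.dist a v ∧ K.Adj (par v) v) (v : V) (hv : H.Reachable a v) :
    ∃ A : Finset V, a ∈ A ∧ v ∈ A ∧ (K.induce (A : Set V)).Connected ∧
      A.card ≤ H.dist a v + 1 := by
  induction hk : H.dist a v generalizing v with
  | zero =>
    obtain rfl : a = v := (hv.dist_eq_zero_iff).1 hk
    refine ⟨{a}, by simp, by simp, ?_, by simp⟩
    rw [Finset.coe_singleton]
    have : Subsingleton ({a} : Set V) := inferInstance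
    exact ⟨.of_subsingleton⟩
  | succ k ih =>
    have hva : v ≠ a := by rintro rfl; simp at hk
    obtain ⟨h1, h2, h3⟩ := hpar v hv hva
    obtain ⟨A, ha, hpA, hA, hc⟩ := ih (par v) h1 (by omega)
    refine ⟨A ∪ {par v, v}, by simp [ha], by simp, ?_, ?_⟩
    · rw [Finset.coe_union, Finset.coe_pair]
      exact induce_union_connected hA.preconnected (induce_pair_connected_of_adj h3).preconnected
        ⟨par v, hpA, by simp⟩
    · have : A ∪ {par v, v} = insert v A := by ext x; simp; grind
      rw [this]
      exact (Finset.card_insert_le _ _).trans (by omega)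

theorem Reachable.exists_parent {H : SimpleGraph V} {a v : V} (h : H.Reachable a v) (hne : v ≠ a) :
    ∃ w, H.Reachable a w ∧ H.dist a w + 1 = H.dist a v ∧ H.Adj w v := by
  obtain ⟨p, hp⟩ := h.exists_walk_length_eq_dist
  have hnil : ¬ p.Nil := fun hn => hne hn.eq.symm
  have hadj := p.adj_penultimate hnil
  have hlen := congrArg Walk.length (p.concat_dropLast hadj)
  simp only [Walk.length_concat] at hlen
  have h1 := dist_le p.dropLast
  have h2 : H.dist a v ≤ H.dist a p.penultimate + 1 := by
    obtain ⟨q, hq⟩ := p.dropLast.reachable.exists_walk_length_eq_dist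
    have := dist_le (q.concat hadj)
    rw [Walk.length_concat] at this
    omega
  exact ⟨p.penultimate, p.dropLast.reachable, by omega, hadj⟩

variable [Fintype V] {G H : SimpleGraph V}

/-- A subgraph with components of small diameter is a near-forest, provided that no small set of
vertices spans a connected graph with two redundant edges. -/
theorem isNearForest_of_edist_lt {L : ℕ} (hHG : H ≤ G)
    (hdiam : ∀ a b, H.Reachable a b → H.edist a b < L)
    (hcyc : ∀ (A : Finset V) (e f : Sym2 V), A.card ≤ 4 * L → e ≠ f → e ∈ G.edgeSet →
      f ∈ G.edgeSet → (∀ x ∈ e, x ∈ A) → (∀ x ∈ f, x ∈ A) →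
      ¬ ((G.deleteEdges {e, f}).induce (A : Set V)).Connected) :
    H.IsNearForest := by
  classical
  intro C
  by_contra hcon
  rw [treeExcess, not_le] at hcon
  obtain ⟨a, ha⟩ := C.exists_rep
  have hmemC : ∀ v, v ∈ C.supp ↔ H.Reachable a v := by
    intro v
    rw [ConnectedComponent.mem_supp_iff, ← ha]
    change H.connectedComponentMk v = H.connectedComponentMk a ↔ _
    rw [ConnectedComponent.eq]
    exact reachable_comm
  set S : Finset V := Finset.univ.filter fun v => H.Reachable a v with hS
  set E : Finset (Sym2 V) := H.edgeFinset.filter fun e => ∀ x ∈ e, x ∈ S with hE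
  have hV : Nat.card C = S.card := by
    have : (C.supp : Set V) = (S : Set V) := by ext v; simp [hS, hmemC]
    have h2 : Nat.card C = Nat.card (C.supp : Set V) := rfl
    rw [h2, this, Nat.card_coe_set_eq, Set.ncard_coe_finset]
  have hEcard : Nat.card C.toSimpleGraph.edgeSet ≤ E.card := by
    let φ : C.toSimpleGraph.edgeSet → (E : Set (Sym2 V)) := fun e =>
      ⟨Sym2.map (fun x : C => (x : V)) e.1, by
        obtain ⟨e, he⟩ := e
        induction e with
        | h x y =>
          have hxy : H.Adj (x : V) (y : V) := he
          have hx : H.Reachable a x := (hmemC _).1 x.2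
          have hy : H.Reachable a y := (hmemC _).1 y.2
          simp [hE, hS, hxy, hx, hy]⟩
    have hφ : Function.Injective φ := by
      intro e f hef
      have : Sym2.map (fun x : C => (x : V)) e.1 = Sym2.map (fun x : C => (x : V)) f.1 :=
        congrArg Subtype.val hef
      exact Subtype.ext (Sym2.map.injective Subtype.val_injective this)
    have := Nat.card_le_card_of_injective φ hφ
    rwa [Nat.card_coe_set_eq (E : Set (Sym2 V)), Set.ncard_coe_finset] at this
  have hparex : ∀ v, ∃ w, (H.Reachable a v → v ≠ a →
      H.Reachable a w ∧ H.dist a w + 1 = H.dist a v ∧ H.Adj w v) := by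
    intro v
    by_cases h : H.Reachable a v ∧ v ≠ a
    · obtain ⟨w, hw⟩ := h.1.exists_parent h.2
      exact ⟨w, fun _ _ => hw⟩
    · exact ⟨a, fun h1 h2 => absurd ⟨h1, h2⟩ h⟩
  choose par hpar using hparex
  -- The edges of a breadth-first tree rooted at `a`. Tree-excess at least 2 leaves two edges `e ≠
  -- f` outside it, and the tree branches to their four endpoints, of at most `L` vertices each,
  -- stay connected without them.
  set F : Finset (Sym2 V) := (S.erase a).image fun v => s(par v, v) with hF
  have haS : a ∈ S := by simp [hS]
  have hFcard : F.card + 1 ≤ S.card := by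
    have h1 : F.card ≤ (S.erase a).card := Finset.card_image_le
    have h2 := Finset.card_erase_add_one haS
    omega
  have hEF : 1 < (E \ F).card := by
    have h1 := Finset.le_card_sdiff F E
    omega
  obtain ⟨e, he, f, hf, hef⟩ := Finset.one_lt_card.1 hEF
  set K := G.deleteEdges {e, f} with hK
  have hKpar : ∀ v, H.Reachable a v → v ≠ a → H.Reachable a (par v) ∧
      H.dist a (par v) + 1 = H.dist a v ∧ K.Adj (par v) v := by
    intro v hv hva
    obtain ⟨h1, h2, h3⟩ := hpar v hv hva
    refine ⟨h1, h2, ?_⟩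
    have hvF : s(par v, v) ∈ F :=
      Finset.mem_image.2 ⟨v, by simp [hS, hv, hva], rfl⟩
    rw [hK, deleteEdges_adj]
    refine ⟨hHG h3, ?_⟩
    rintro (h | h)
    · exact (Finset.mem_sdiff.1 he).2 (h ▸ hvF)
    · exact (Finset.mem_sdiff.1 hf).2 (h ▸ hvF)
  have hchain : ∀ v ∈ S, ∃ A : Finset V, a ∈ A ∧ v ∈ A ∧ (K.induce (A : Set V)).Connected ∧
      A.card ≤ L := by
    intro v hv
    have hv' : H.Reachable a v := by simpa [hS] using hv
    obtain ⟨A, h1, h2, h3, h4⟩ := exists_connected_of_parent par hKpar v hv'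
    refine ⟨A, h1, h2, h3, h4.trans ?_⟩
    have := hdiam a v hv'
    rw [← hv'.coe_dist_eq_edist] at this
    exact_mod_cast this
  have hpair : ∀ e ∈ E, ∃ A : Finset V, a ∈ A ∧ (∀ x ∈ e, x ∈ A) ∧
      (K.induce (A : Set V)).Connected ∧ A.card ≤ 2 * L := by
    intro e he
    have hx := (Finset.mem_filter.1 he).2
    induction e with
    | h x y =>
      obtain ⟨A, h1, h2, h3, h4⟩ := hchain x (hx x (by simp))
      obtain ⟨B, k1, k2, k3, k4⟩ := hchain y (hx y (by simp))
      refine ⟨A ∪ B, by simp [h1], by simp [h2, k2], ?_, (Finset.card_union_le _ _).trans (by omega)⟩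
      rw [Finset.coe_union]
      exact induce_union_connected h3.preconnected k3.preconnected ⟨a, h1, k1⟩
  obtain ⟨A, h1, h2, h3, h4⟩ := hpair e (Finset.mem_sdiff.1 he).1
  obtain ⟨B, k1, k2, k3, k4⟩ := hpair f (Finset.mem_sdiff.1 hf).1
  have hedge : ∀ e ∈ E, e ∈ G.edgeSet := fun e he =>
    edgeSet_mono hHG (mem_edgeFinset.1 (Finset.mem_filter.1 he).1)
  refine hcyc (A ∪ B) e f ((Finset.card_union_le _ _).trans (by omega)) hef
    (hedge e (Finset.mem_sdiff.1 he).1) (hedge f (Finset.mem_sdiff.1 hf).1)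
    (fun x hx => Finset.mem_union_left _ (h2 x hx))
    (fun x hx => Finset.mem_union_right _ (k2 x hx)) ?_
  rw [Finset.coe_union]
  exact induce_union_connected h3.preconnected k3.preconnected ⟨a, h1, k1⟩

/-- The deterministic decomposition: the edges touching the large balls form `G₂`. -/
theorem exists_decomposition {D D₁ θ T Δ : ℝ} {L : ℕ} (hD1 : 1 ≤ D) (hD₁ : 2 ≤ D₁) (hθ : 0 < θ)
    (hθ1 : θ < 1) (hD : D₁ * Real.exp (2 * θ) ≤ D) (hT : 21 ≤ θ * T) (hL : 1 ≤ L)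
    (hexp : ∀ A A' : Finset V, (G.induce (A : Set V)).Connected → A' ⊆ A → L ≤ A.card →
      (A.card : ℝ) ≤ T * A'.card → ((G.closedNbhd A').card : ℝ) < D₁ * A'.card)
    (hcyc : ∀ (A : Finset V) (e f : Sym2 V), A.card ≤ 4 * L → e ≠ f → e ∈ G.edgeSet →
      f ∈ G.edgeSet → (∀ x ∈ e, x ∈ A) → (∀ x ∈ f, x ∈ A) →
      ¬ ((G.deleteEdges {e, f}).induce (A : Set V)).Connected)
    (hball : ∀ r : ℕ, 1 ≤ r → ∀ u, ((G.ballFinset u r).card : ℝ) ≤ D ^ (r - 1) * Δ) :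
    ∃ G₁ G₂ : SimpleGraph V,
      G₁.edgeSet ∪ G₂.edgeSet = G.edgeSet ∧ Disjoint G₁.edgeSet G₂.edgeSet ∧
      (∀ v, ((G₁.neighborSet v).ncard : ℝ) ≤ D) ∧ G₂.IsNearForest ∧
      G₂.IsPseudorandom Δ D (G₁.support ∩ G₂.support) := by
  classical
  set W := G.largeBallCover D with hW
  have hncard : ∀ u r, ((G.touching W).distBall u r) ⊆ (G.ballFinset u r : Set V) := by
    intro u r v hv
    rw [coe_ballFinset]
    exact (edist_anti (G.touching_le W)).trans hv
  refine ⟨G.avoiding W, G.touching W, ?_, ?_, ?_, ?_, ?_, ?_⟩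
  · ext e
    induction e with
    | h x y => simp only [Set.mem_union, mem_edgeSet, avoiding, touching]; tauto
  · rw [Set.disjoint_left]
    intro e
    induction e with
    | h x y => simp only [mem_edgeSet, avoiding, touching]; tauto
  · intro v
    by_cases hv : v ∈ W
    · have : (G.avoiding W).neighborSet v = ∅ := by
        ext x; simp [avoiding, mem_neighborSet, hv]
      rw [this]
      simpa using le_trans zero_le_one hD1
    · have h1 : ((G.ballFinset v 1).card : ℝ) ≤ D := by
        by_contra h
        exact hv ⟨v, 1, by simpa using h, self_mem_ballFinset⟩
      have h2 : (G.avoiding W).neighborSet v ⊆ (G.ballFinset v 1 : Set V) := by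
        intro x hx
        have : G.Adj v x := hx.1
        exact Finset.mem_coe.2 (mem_ballFinset.2 (by simpa using (edist_eq_one_iff_adj.2 this).le))
      have h3 := Set.ncard_le_ncard h2
      rw [Set.ncard_coe_finset] at h3
      exact le_trans (by exact_mod_cast h3) h1
  · exact isNearForest_of_edist_lt (G.touching_le W)
      (fun a b hab => edist_touching_lt hD1 hD₁ hθ hθ1 hD hT hL hexp hab) hcyc
  · intro r hr u
    have h3 := Set.ncard_le_ncard (hncard u r)
    rw [Set.ncard_coe_finset] at h3
    exact le_trans (by exact_mod_cast h3) (hball r hr u)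
  · intro r u
    by_cases h : D ^ r < (G.ballFinset u r).card
    -- A large ball lies in `W`, whose vertices are isolated in the first graph.
    · have : (G.avoiding W).support ∩ (G.touching W).support ∩ (G.touching W).distBall u r = ∅ := by
        rw [Set.eq_empty_iff_forall_notMem]
        rintro x ⟨⟨⟨y, hy⟩, -⟩, hx⟩
        exact hy.2.1 ⟨u, r, h, Finset.mem_coe.1 (hncard u r hx)⟩
      rw [this]
      simp only [Set.ncard_empty, Nat.cast_zero]
      positivity
    · have h3 := Set.ncard_le_ncard (Set.inter_subset_right.trans (hncard u r) :
        (G.avoiding W).support ∩ (G.touching W).support ∩ (G.touching W).distBall u r ⊆ _)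
      rw [Set.ncard_coe_finset] at h3
      exact le_trans (by exact_mod_cast h3) (not_lt.1 h)

end SimpleGraph

/-! ### Growth of balls -/

namespace SimpleGraph

variable {V : Type*}

section Growth

variable [Fintype V] {G : SimpleGraph V}

/-- Ball growth: `R` slow initial steps, followed by growth by a factor of at most `D` per step once
the ball has size at least `L`. -/
theorem card_ballFinset_le {D δ l K : ℝ} {L R : ℕ} (α : ℕ → ℝ) (hD : 1 ≤ D) (hl : 0 ≤ l)
    (hδ : 0 ≤ δ) (hα0 : 1 ≤ α 0 * l) (hαδ : ∀ j ≤ R + 1, α j ≤ δ)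
    (hslow : ∀ j ≤ R, ∀ A : Finset V, (G.induce (A : Set V)).Connected → (A.card : ℝ) ≤ α j * l →
      ((G.closedNbhd A).card : ℝ) ≤ α (j + 1) * l)
    (hsmall : ∀ A : Finset V, (G.induce (A : Set V)).Connected → A.card < L →
      ((G.closedNbhd A).card : ℝ) ≤ K * l)
    (hlarge : ∀ A : Finset V, (G.induce (A : Set V)).Connected → L ≤ A.card →
      ((G.closedNbhd A).card : ℝ) ≤ D * A.card)
    (hK : K ≤ D ^ R * δ) (r : ℕ) (hr : 1 ≤ r) (u : V) :
    ((G.ballFinset u r).card : ℝ) ≤ D ^ (r - 1) * (δ * l) := by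
  have hstart : ∀ j ≤ R + 1, ((G.ballFinset u j).card : ℝ) ≤ α j * l := by
    intro j hj
    induction j with
    | zero => simpa [ballFinset_zero] using hα0
    | succ k ih =>
      rw [← closedNbhd_ballFinset]
      exact hslow k (by omega) _ connected_induce_ballFinset (ih (by omega))
  -- From radius `R + 2` on, the target exceeds `K * l`, which settles the step from a ball below
  -- size `L`; a larger ball grows by a factor of at most `D`.
  rcases Nat.lt_or_ge r (R + 2) with h | h
  · calc ((G.ballFinset u r).card : ℝ) ≤ α r * l := hstart r (by omega)
      _ ≤ δ * l := by gcongr; exact hαδ r (by omega)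
      _ ≤ D ^ (r - 1) * (δ * l) := le_mul_of_one_le_left (by positivity) (one_le_pow₀ hD)
  · induction r, h using Nat.le_induction with
    | base =>
      have h1 := hstart (R + 1) le_rfl
      rw [show R + 2 - 1 = R + 1 from rfl, ← closedNbhd_ballFinset (r := R + 1)]
      rcases Nat.lt_or_ge (G.ballFinset u (R + 1)).card L with h | h
      · calc _ ≤ K * l := hsmall _ connected_induce_ballFinset h
          _ ≤ D ^ R * δ * l := by gcongr
          _ ≤ D ^ (R + 1) * δ * l := by gcongr; omega
          _ = _ := by ring
      · calc _ ≤ D * (G.ballFinset u (R + 1)).card := hlarge _ connected_induce_ballFinset h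
          _ ≤ D * (α (R + 1) * l) := by gcongr
          _ ≤ D * (δ * l) := by gcongr; exact hαδ _ le_rfl
          _ ≤ D ^ (R + 1) * (δ * l) := by gcongr; exact le_self_pow₀ hD (by omega)
    | succ k hk ih =>
      have ih := ih (by omega)
      rw [← closedNbhd_ballFinset, show k + 1 - 1 = k from rfl]
      rcases Nat.lt_or_ge (G.ballFinset u k).card L with h | h
      · calc _ ≤ K * l := hsmall _ connected_induce_ballFinset h
          _ ≤ D ^ R * δ * l := by gcongr
          _ ≤ D ^ k * δ * l := by gcongr; omega
          _ = _ := by ring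
      · calc _ ≤ D * (G.ballFinset u k).card := hlarge _ connected_induce_ballFinset h
          _ ≤ D * (D ^ (k - 1) * (δ * l)) := by gcongr
          _ = D ^ (k - 1 + 1) * (δ * l) := by ring
          _ = _ := by rw [Nat.sub_add_cancel (by omega)]

end Growth

/-! ### Splitting a connected set at a vertex -/

section Split

variable {G : SimpleGraph V}

/-- Connectedness of an induced subgraph, in terms of chains of adjacent vertices. -/
theorem connected_induce_iff_reflTransGen {A : Set V} {u : V} (hu : u ∈ A) :
    (G.induce A).Connected ↔
      ∀ v ∈ A, Relation.ReflTransGen (fun x y => G.Adj x y ∧ x ∈ A ∧ y ∈ A) u v := by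
  constructor
  · intro h v hv
    have h1 := reachable_iff_reflTransGen _ _ |>.1 (h.preconnected ⟨u, hu⟩ ⟨v, hv⟩)
    exact h1.lift Subtype.val fun x y hxy => ⟨hxy, x.2, y.2⟩
  · intro h
    rw [connected_iff_exists_forall_reachable]
    refine ⟨⟨u, hu⟩, ?_⟩
    rintro ⟨v, hv⟩
    have key : ∀ v, Relation.ReflTransGen (fun x y => G.Adj x y ∧ x ∈ A ∧ y ∈ A) u v →
        ∃ hv : v ∈ A, (G.induce A).Reachable ⟨u, hu⟩ ⟨v, hv⟩ := by
      intro v hv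
      induction hv with
      | refl => exact ⟨hu, .rfl⟩
      | tail _ hxy ih =>
        obtain ⟨hx, hr⟩ := ih
        refine ⟨hxy.2.2, hr.trans (Adj.reachable ?_)⟩
        exact hxy.1
    exact (key v (h v hv)).2

/-- A connected set with at least two vertices splits into two connected sets joined by an edge at
a prescribed vertex. -/
theorem exists_split_of_connected [DecidableEq V] {A : Finset V} {u : V}
    (hA : (G.induce (A : Set V)).Connected) (hu : u ∈ A) (hne : A ≠ {u}) :
    ∃ c, ∃ B ⊆ A.erase u, c ∈ B ∧ G.Adj u c ∧ (G.induce (B : Set V)).Connected ∧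
      (G.induce ((A \ B : Finset V) : Set V)).Connected := by
  classical
  obtain ⟨v, hv⟩ : (A.erase u).Nonempty := by
    rw [Finset.nonempty_iff_ne_empty]
    intro h
    rcases Finset.erase_eq_empty_iff A u |>.1 h with h | h
    · simp [h] at hu
    · exact hne h
  set R : V → V → Prop := fun x y => G.Adj x y ∧ x ∈ A.erase u ∧ y ∈ A.erase u with hR
  -- `B` is the component of `v` in `A` without `u`, so its only exit within `A` is `u`.
  set B : Finset V := (A.erase u).filter fun x => Relation.ReflTransGen R v x with hB
  have hBsub : B ⊆ A.erase u := Finset.filter_subset _ _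
  have huB : u ∉ B := fun h => Finset.notMem_erase u A (hBsub h)
  have hvB : v ∈ B := Finset.mem_filter.2 ⟨hv, .refl⟩
  have hclosed : ∀ x ∈ B, ∀ y ∈ A, G.Adj x y → y ∉ B → y = u := by
    intro x hx y hy hxy hyB
    by_contra hyu
    have hy' : y ∈ A.erase u := Finset.mem_erase.2 ⟨hyu, hy⟩
    exact hyB (Finset.mem_filter.2 ⟨hy', (Finset.mem_filter.1 hx).2.tail ⟨hxy, hBsub hx, hy'⟩⟩)
  have hBconn : (G.induce (B : Set V)).Connected := by
    rw [connected_induce_iff_reflTransGen (Finset.mem_coe.2 hvB)]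
    intro x hx
    have hvx := (Finset.mem_filter.1 (Finset.mem_coe.1 hx)).2
    clear hx
    induction hvx with
    | refl => exact .refl
    | tail h1 h2 ih =>
      exact ih.tail ⟨h2.1, Finset.mem_filter.2 ⟨h2.2.1, h1⟩,
        Finset.mem_filter.2 ⟨h2.2.2, h1.tail h2⟩⟩
  have hAu := (connected_induce_iff_reflTransGen (Finset.mem_coe.2 hu)).1 hA
  have hcompl : (G.induce ((A \ B : Finset V) : Set V)).Connected := by
    rw [connected_induce_iff_reflTransGen
      (Finset.mem_coe.2 (Finset.mem_sdiff.2 ⟨hu, huB⟩) : u ∈ ((A \ B : Finset V) : Set V))]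
    intro x hx
    obtain ⟨hxA, hxB⟩ := Finset.mem_sdiff.1 (Finset.mem_coe.1 hx)
    -- A chain from `u` can leave `B` only to `u`, where it may be restarted.
    have h := hAu x hxA
    clear hx
    induction h with
    | refl => exact .refl
    | @tail y z h1 h2 ih =>
      by_cases hy : y ∈ B
      · rw [hclosed y hy z hxA h2.1 hxB]
      · refine (ih h2.2.1 hy).tail ⟨h2.1, ?_, ?_⟩
        · exact Finset.mem_coe.2 (Finset.mem_sdiff.2 ⟨h2.2.1, hy⟩)
        · exact Finset.mem_coe.2 (Finset.mem_sdiff.2 ⟨hxA, hxB⟩)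
  obtain ⟨c, hcB, hcu⟩ : ∃ c ∈ B, G.Adj u c := by
    by_contra hcon
    push Not at hcon
    have : ∀ x, Relation.ReflTransGen (fun x y => G.Adj x y ∧ x ∈ (A : Set V) ∧ y ∈ (A : Set V))
        u x → x ∉ B := by
      intro x hx
      induction hx with
      | refl => exact huB
      | @tail y z h1 h2 ih =>
        intro hz
        have hyu := hclosed z hz y h2.2.1 h2.1.symm ih
        exact hcon z hz (hyu ▸ h2.1)
    exact this v (hAu v (Finset.mem_of_mem_erase hv)) hvB
  exact ⟨c, B, hBsub, hcB, hcu, hBconn, hcompl⟩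

end Split

end SimpleGraph

/-! ### Generating function of connected sets -/

section WeightedCount

variable {V : Type*} [Fintype V] [DecidableEq V]

open Finset in
/-- Generating-function bound for a set function that splits along edges: the weights
`(4 q) ^ (-|A|) P A` of the sets containing a given vertex sum to at most `1 / (2 q)`. -/
theorem sum_pow_mul_le_of_split {P : Finset V → ℝ} {p : V → V → ℝ} {q : ℝ} (hq : 0 < q)
    (hP0 : ∀ A, 0 ≤ P A) (hP1 : ∀ A, P A ≤ 1) (hp0 : ∀ u v, 0 ≤ p u v)
    (hrow : ∀ u, ∑ v, p u v ≤ q)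
    (hsplit : ∀ A u, u ∈ A → A ≠ {u} →
      P A ≤ ∑ c, ∑ B ∈ (A.erase u).powerset with c ∈ B, p u c * P (A \ B) * P B) (u : V) :
    ∑ A with u ∈ A, (4 * q)⁻¹ ^ A.card * P A ≤ (2 * q)⁻¹ := by
  -- Splitting gives the recursion `x ≤ t + q x²`; this `t` is the largest one with a fixed point,
  -- namely `x = 1 / (2q)`.
  set t : ℝ := (4 * q)⁻¹ with ht
  have ht0 : 0 < t := by positivity
  set w : Finset V → ℝ := fun A => t ^ A.card * P A with hw
  have hw0 : ∀ A, 0 ≤ w A := fun A => mul_nonneg (by positivity) (hP0 A)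
  -- Truncating by cardinality permits induction: both pieces of a split are nonempty, hence smaller
  -- than `A`.
  have key : ∀ N : ℕ, ∀ u, ∑ A with u ∈ A ∧ A.card ≤ N, w A ≤ (2 * q)⁻¹ := by
    intro N
    induction N with
    | zero =>
      intro u
      have : (univ.filter fun A : Finset V => u ∈ A ∧ A.card ≤ 0) = ∅ := by
        ext A
        simp only [mem_filter, mem_univ, true_and, Nat.le_zero, card_eq_zero, notMem_empty,
          iff_false, not_and]
        rintro h rfl
        simp at h
      rw [this, sum_empty]
      positivity
    | succ N ih =>
      intro u
      set 𝒮 := univ.filter fun A : Finset V => u ∈ A ∧ A.card ≤ N + 1 with h𝒮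
      have hu𝒮 : {u} ∈ 𝒮 := by simp [h𝒮]
      rw [← add_sum_erase _ _ hu𝒮]
      have h1 : w {u} ≤ t := by
        simp only [hw, card_singleton, pow_one]
        exact mul_le_of_le_one_right ht0.le (hP1 _)
      have h2 : ∀ A ∈ 𝒮.erase {u}, w A ≤
          ∑ c, ∑ B ∈ (A.erase u).powerset with c ∈ B, p u c * (w (A \ B) * w B) := by
        intro A hA
        obtain ⟨hAne, hA⟩ := mem_erase.1 hA
        have huA : u ∈ A := by simp only [h𝒮, mem_filter] at hA; exact hA.2.1
        calc w A ≤ t ^ A.card *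
              ∑ c, ∑ B ∈ (A.erase u).powerset with c ∈ B, p u c * P (A \ B) * P B := by
              simp only [hw]; gcongr; exact hsplit A u huA hAne
          _ = _ := by
            rw [mul_sum]
            refine sum_congr rfl fun c _ => ?_
            rw [mul_sum]
            refine sum_congr rfl fun B hB => ?_
            have hBA : B ⊆ A := (mem_powerset.1 (mem_filter.1 hB).1).trans (erase_subset _ _)
            simp only [hw]
            rw [← card_sdiff_add_card_eq_card hBA, pow_add]
            ring
      have h3 : ∀ c, ∑ A ∈ 𝒮.erase {u}, ∑ B ∈ (A.erase u).powerset with c ∈ B,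
          w (A \ B) * w B ≤ (2 * q)⁻¹ * (2 * q)⁻¹ := by
        intro c
        refine le_trans ?_ (mul_le_mul (ih u) (ih c) (sum_nonneg fun A _ => hw0 A) (by positivity))
        rw [sum_mul_sum, ← sum_product', sum_sigma']
        set 𝒟 := (𝒮.erase {u}).sigma fun A => (A.erase u).powerset.filter fun B => c ∈ B with h𝒟
        -- `A` is recovered as the union of its two pieces, so the sum over splits is bounded by a
        -- product of two sums.
        have hinj : Set.InjOn (fun x : (_ : Finset V) × Finset V => (x.1 \ x.2, x.2)) 𝒟 := by
          rintro ⟨A, B⟩ h ⟨A', B'⟩ h' heq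
          simp only [h𝒟, coe_sigma, Set.mem_sigma_iff, mem_coe, mem_filter, mem_powerset] at h h'
          simp only [Prod.mk.injEq] at heq
          obtain ⟨e1, rfl⟩ := heq
          have hB := h.2.1.trans (erase_subset u A)
          have hB' := h'.2.1.trans (erase_subset u A')
          have : A = A' := by
            rw [← sdiff_union_of_subset hB, ← sdiff_union_of_subset hB', e1]
          subst this
          rfl
        have hsum := sum_image (f := fun y : Finset V × Finset V => w y.1 * w y.2) hinj
        simp only at hsum
        rw [← hsum]
        refine sum_le_sum_of_subset_of_nonneg ?_ fun y _ _ => mul_nonneg (hw0 _) (hw0 _)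
        intro y hy
        obtain ⟨⟨A, B⟩, h, rfl⟩ := mem_image.1 hy
        simp only [h𝒟, mem_sigma, mem_filter, mem_powerset, h𝒮, mem_erase, mem_univ,
          true_and] at h
        obtain ⟨⟨-, huA, hcard⟩, hBA, hcB⟩ := h
        have huB : u ∉ B := fun h => notMem_erase u A (hBA h)
        have hBA' := hBA.trans (erase_subset u A)
        have e1 := card_sdiff_add_card_eq_card hBA'
        have e2 : 0 < B.card := card_pos.2 ⟨c, hcB⟩
        have e3 : 0 < (A \ B).card := card_pos.2 ⟨u, mem_sdiff.2 ⟨huA, huB⟩⟩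
        simp only [mem_product, mem_filter, mem_univ, true_and]
        exact ⟨⟨mem_sdiff.2 ⟨huA, huB⟩, by omega⟩, hcB, by omega⟩
      have h4 : ∑ A ∈ 𝒮.erase {u}, w A ≤ q * ((2 * q)⁻¹ * (2 * q)⁻¹) := by
        calc ∑ A ∈ 𝒮.erase {u}, w A
            ≤ ∑ A ∈ 𝒮.erase {u}, ∑ c, ∑ B ∈ (A.erase u).powerset with c ∈ B,
              p u c * (w (A \ B) * w B) := sum_le_sum h2
          _ = ∑ c, p u c * ∑ A ∈ 𝒮.erase {u}, ∑ B ∈ (A.erase u).powerset with c ∈ B,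
              w (A \ B) * w B := by
            rw [sum_comm]
            simp only [mul_sum]
          _ ≤ ∑ c, p u c * ((2 * q)⁻¹ * (2 * q)⁻¹) :=
            sum_le_sum fun c _ => mul_le_mul_of_nonneg_left (h3 c) (hp0 u c)
          _ ≤ q * ((2 * q)⁻¹ * (2 * q)⁻¹) := by
            rw [← sum_mul]
            exact mul_le_mul_of_nonneg_right (hrow u) (by positivity)
      calc w {u} + ∑ A ∈ 𝒮.erase {u}, w A ≤ t + q * ((2 * q)⁻¹ * (2 * q)⁻¹) := add_le_add h1 h4
        _ = (2 * q)⁻¹ := by rw [ht]; field_simp; norm_num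
  refine le_trans (le_of_eq ?_) (key (Fintype.card V) u)
  refine sum_congr ?_ fun _ _ => rfl
  ext A
  simp [card_le_univ]

end WeightedCount

/-! ### Independent edges and connectedness probabilities -/

section IndependentCoins

variable {V : Type*}

/-- The graph of the successful coins. -/
def coinGraph (ω : Sym2 V → Prop) : SimpleGraph V := SimpleGraph.fromEdgeSet {e | ω e}

theorem coinGraph_adj {ω : Sym2 V → Prop} {u v : V} :
    (coinGraph ω).Adj u v ↔ ω s(u, v) ∧ u ≠ v := by
  simp [coinGraph]

/-- The event that `A` induces a connected subgraph after the deletion of the edges in `S` depends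
only on the remaining coins inside `A`. -/
theorem dependsOn_connected_deleteEdges [DecidableEq V] (A : Finset V) (S : Finset (Sym2 V)) :
    DependsOn (fun ω : Sym2 V → Prop =>
      (((coinGraph ω).deleteEdges (S : Set (Sym2 V))).induce (A : Set V)).Connected)
      ((A.sym2 \ S : Finset (Sym2 V)) : Set (Sym2 V)) := by
  intro ω ω' h
  have : ((coinGraph ω).deleteEdges (S : Set (Sym2 V))).induce (A : Set V) =
      ((coinGraph ω').deleteEdges (S : Set (Sym2 V))).induce (A : Set V) := by
    ext ⟨x, hx⟩ ⟨y, hy⟩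
    simp only [SimpleGraph.comap_adj, Function.Embedding.subtype_apply,
      SimpleGraph.deleteEdges_adj, coinGraph_adj]
    by_cases hS : s(x, y) ∈ S
    · simp [hS]
    · have hxy : s(x, y) ∈ A.sym2 \ S := by
        rw [Finset.mem_sdiff, Finset.mk_mem_sym2_iff]
        exact ⟨⟨hx, hy⟩, hS⟩
      rw [h s(x, y) (Finset.mem_coe.2 hxy)]
  simp only [this]

theorem dependsOn_connected [DecidableEq V] (A : Finset V) :
    DependsOn (fun ω : Sym2 V → Prop => ((coinGraph ω).induce (A : Set V)).Connected)
      (A.sym2 : Set (Sym2 V)) := by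
  have h := dependsOn_connected_deleteEdges A ∅
  simpa using h

theorem dependsOn_coin (e : Sym2 V) :
    DependsOn (fun ω : Sym2 V → Prop => ω e) (({e} : Finset (Sym2 V)) : Set (Sym2 V)) := by
  intro ω ω' h
  exact h e (by simp)

variable [Fintype V]

/-- The law of independent coins, one for each pair of vertices. -/
noncomputable def coinMeasure (p : Sym2 V → unitInterval) : Measure (Sym2 V → Prop) :=
  Measure.pi fun e => bernoulliMeasure True False (p e)

instance coinMeasure.isProbabilityMeasure (p : Sym2 V → unitInterval) :
    IsProbabilityMeasure (coinMeasure p) := by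
  unfold coinMeasure; infer_instance

theorem measurableSet_coins (s : Set (Sym2 V → Prop)) : MeasurableSet s :=
  s.toFinite.measurableSet

variable (p : Sym2 V → unitInterval)

theorem iIndepFun_coins : iIndepFun (fun (e : Sym2 V) (ω : Sym2 V → Prop) => ω e)
    (coinMeasure p) :=
  iIndepFun_pi (X := fun _ x => x) fun _ => aemeasurable_id

theorem coinMeasure_real_and {P Q : (Sym2 V → Prop) → Prop} {S T : Finset (Sym2 V)}
    (hST : Disjoint S T) (hP : DependsOn P (S : Set (Sym2 V)))
    (hQ : DependsOn Q (T : Set (Sym2 V))) :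
    (coinMeasure p).real {ω | P ω ∧ Q ω} =
      (coinMeasure p).real {ω | P ω} * (coinMeasure p).real {ω | Q ω} := by
  have h := (iIndepFun_coins p).indepFun_finset S T hST fun e => measurable_pi_apply e
  -- An event determined by the coins in `U` is the preimage of its projection to those coordinates.
  have hpre : ∀ (R : (Sym2 V → Prop) → Prop) (U : Finset (Sym2 V)), DependsOn R (U : Set (Sym2 V)) →
      {ω | R ω} = (fun (ω : Sym2 V → Prop) (i : U) => ω i) ⁻¹'
        {x | ∃ ω, R ω ∧ (fun i : U => ω i) = x} := by
    intro R U hR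
    ext ω
    simp only [Set.mem_ofPred_eq, Set.mem_preimage]
    constructor
    · intro hω; exact ⟨ω, hω, rfl⟩
    · rintro ⟨ω', hω', heq⟩
      rw [← hR (x := ω') (y := ω) fun i hi => congrFun heq ⟨i, hi⟩]
      exact hω'
  have h2 := h.measure_inter_preimage_eq_mul _ _
    (Set.toFinite {x | ∃ ω, P ω ∧ (fun i : S => ω i) = x}).measurableSet
    (Set.toFinite {x | ∃ ω, Q ω ∧ (fun i : T => ω i) = x}).measurableSet
  rw [← hpre P S hP, ← hpre Q T hQ] at h2
  rw [Set.ofPred_and, measureReal_def, h2, ENNReal.toReal_mul]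
  rfl

theorem coinMeasure_real_coin (e : Sym2 V) : (coinMeasure p).real {ω | ω e} = p e := by
  have h := (measurePreserving_eval (fun e => bernoulliMeasure True False (p e)) e).measure_preimage
    (s := {x | x}) (Set.toFinite _).measurableSet.nullMeasurableSet
  have h1 : (coinMeasure p).real {ω | ω e} = (bernoulliMeasure True False (p e)).real {x | x} := by
    rw [measureReal_def, measureReal_def, ← h]; rfl
  rw [h1, bernoulliMeasure_real_apply_of_mem_of_notMem _ (Set.toFinite _).measurableSet] <;> simp

/-- Chernoff bound for the number of successful coins in a finite set. -/
theorem coinMeasure_real_card_ge (F : Finset (Sym2 V)) [∀ ω : Sym2 V → Prop, DecidablePred ω]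
    {s b m : ℝ} (hs : 0 ≤ s) (hm : ∑ e ∈ F, (p e : ℝ) ≤ m) :
    (coinMeasure p).real {ω | b ≤ ((F.filter fun e => ω e).card : ℝ)} ≤
      Real.exp (-s * b + (Real.exp s - 1) * m) := by
  set X : Sym2 V → (Sym2 V → Prop) → ℝ := fun e ω => Set.indicator {ω | ω e} 1 ω with hX
  have hXm : ∀ f : (Sym2 V → Prop) → ℝ, Measurable f := fun f => measurable_of_finite f
  have hind : iIndepFun X (coinMeasure p) := by
    have := (iIndepFun_coins p).comp (fun _ x => Set.indicator {x : Prop | x} (1 : Prop → ℝ) x)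
      (fun _ => measurable_of_finite _)
    exact this
  have hcount : ∀ ω, ((F.filter fun e => ω e).card : ℝ) = (∑ e ∈ F, X e) ω := by
    intro ω
    rw [Finset.sum_apply, Finset.card_filter]
    push_cast
    refine Finset.sum_congr rfl fun e _ => ?_
    simp [hX, Set.indicator_apply]
  have hmgf : ∀ e, mgf (X e) (coinMeasure p) s ≤ Real.exp ((Real.exp s - 1) * p e) := by
    intro e
    have h1 : (fun ω => Real.exp (s * X e ω)) =
        fun ω => 1 + (Real.exp s - 1) * Set.indicator {ω : Sym2 V → Prop | ω e} 1 ω := by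
      ext ω
      by_cases h : ω e <;> simp [hX, Set.indicator_apply, h]
    rw [mgf, h1, integral_add (integrable_const _) (Integrable.of_finite), integral_const_mul,
      integral_indicator_one (measurableSet_coins _), coinMeasure_real_coin]
    simp only [integral_const, probReal_univ, smul_eq_mul, mul_one]
    linarith [Real.add_one_le_exp ((Real.exp s - 1) * (p e : ℝ))]
  have h := measure_ge_le_exp_mul_mgf (μ := coinMeasure p) (X := ∑ e ∈ F, X e) (t := s) b hs
    Integrable.of_finite
  rw [hind.mgf_sum (fun e => hXm _)] at h
  have hset : {ω | b ≤ ((F.filter fun e => ω e).card : ℝ)} =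
      {ω | b ≤ (∑ e ∈ F, X e) ω} := by ext ω; simp only [Set.mem_ofPred_eq, hcount]
  rw [hset]
  refine h.trans ?_
  rw [Real.exp_add]
  refine mul_le_mul_of_nonneg_left ?_ (Real.exp_pos _).le
  calc ∏ e ∈ F, mgf (X e) (coinMeasure p) s ≤ ∏ e ∈ F, Real.exp ((Real.exp s - 1) * p e) :=
        Finset.prod_le_prod (fun e _ => mgf_nonneg) fun e _ => hmgf e
    _ = Real.exp ((Real.exp s - 1) * ∑ e ∈ F, (p e : ℝ)) := by
      rw [← Real.exp_sum, Finset.mul_sum]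
    _ ≤ _ := by
      have : 0 ≤ Real.exp s - 1 := by linarith [Real.add_one_le_exp s]
      gcongr

/-- The probability that `A` induces a connected subgraph. -/
noncomputable def connProb (A : Finset V) : ℝ :=
  (coinMeasure p).real {ω | ((coinGraph ω).induce (A : Set V)).Connected}

theorem connProb_nonneg (A : Finset V) : 0 ≤ connProb p A := measureReal_nonneg

variable [DecidableEq V]

/-- A union bound over splits: the edge at `u`, the inside of `B` and the inside of `A \ B` use
disjoint sets of coins. -/
theorem connProb_le_split (A : Finset V) (u : V) (hu : u ∈ A) (hne : A ≠ {u}) :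
    connProb p A ≤ ∑ c, ∑ B ∈ (A.erase u).powerset with c ∈ B,
      (p s(u, c) : ℝ) * connProb p (A \ B) * connProb p B := by
  have hsub : {ω | ((coinGraph ω).induce (A : Set V)).Connected} ⊆
      ⋃ c, ⋃ B ∈ (A.erase u).powerset.filter fun B => c ∈ B,
        {ω : Sym2 V → Prop | (ω s(u, c) ∧
          ((coinGraph ω).induce ((A \ B : Finset V) : Set V)).Connected) ∧
          ((coinGraph ω).induce (B : Set V)).Connected} := by
    intro ω hω
    obtain ⟨c, B, hB, hc, hadj, h1, h2⟩ := SimpleGraph.exists_split_of_connected hω hu hne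
    simp only [Set.mem_iUnion]
    exact ⟨c, B, Finset.mem_filter.2 ⟨Finset.mem_powerset.2 hB, hc⟩,
      ⟨(coinGraph_adj.1 hadj).1, h2⟩, h1⟩
  refine (measureReal_mono hsub).trans ((measureReal_iUnion_fintype_le _).trans
    (Finset.sum_le_sum fun c _ => (measureReal_biUnion_finset_le _ _).trans
      (Finset.sum_le_sum fun B hB => le_of_eq ?_)))
  obtain ⟨hB, hc⟩ := Finset.mem_filter.1 hB
  have hBu : u ∉ B := fun h => Finset.notMem_erase u A (Finset.mem_powerset.1 hB h)
  have hd1 : Disjoint ({s(u, c)} : Finset (Sym2 V)) (A \ B).sym2 := by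
    simp [hc]
  have hd2 : Disjoint ({s(u, c)} ∪ (A \ B).sym2) B.sym2 := by
    rw [Finset.disjoint_left]
    intro e he heB
    rw [Finset.mem_union, Finset.mem_singleton] at he
    rcases he with rfl | he
    · exact hBu (Finset.mk_mem_sym2_iff.1 heB).1
    · induction e with
      | h x y =>
        have h1 := (Finset.mk_mem_sym2_iff.1 he).1
        have h2 := (Finset.mk_mem_sym2_iff.1 heB).1
        exact (Finset.mem_sdiff.1 h1).2 h2
  have hdep : DependsOn (fun ω : Sym2 V → Prop => ω s(u, c) ∧
      ((coinGraph ω).induce ((A \ B : Finset V) : Set V)).Connected)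
      (({s(u, c)} ∪ (A \ B).sym2 : Finset (Sym2 V)) : Set (Sym2 V)) := by
    intro ω ω' h
    have e1 := dependsOn_coin s(u, c) (x := ω) (y := ω') fun i hi => h i (by
      rw [Finset.coe_union]; exact Or.inl hi)
    have e2 := dependsOn_connected (A \ B) (x := ω) (y := ω') fun i hi => h i (by
      rw [Finset.coe_union]; exact Or.inr hi)
    simp only at e1 e2
    simp only [e1, e2]
  rw [coinMeasure_real_and p hd2 hdep (dependsOn_connected B),
    coinMeasure_real_and p hd1 (dependsOn_coin _) (dependsOn_connected _),
    coinMeasure_real_coin]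
  rfl

variable {p} {q : ℝ}

/-- In particular, the expected number of connected `k`-sets containing `u` is at most `(4q)^k /
(2q)`. -/
theorem sum_connProb_le (hq : 0 < q) (hrow : ∀ u, ∑ v, (p s(u, v) : ℝ) ≤ q) (u : V) :
    ∑ A with u ∈ A, (4 * q)⁻¹ ^ A.card * connProb p A ≤ (2 * q)⁻¹ :=
  sum_pow_mul_le_of_split hq (connProb_nonneg p) (fun _ => measureReal_le_one)
    (fun u v => (p s(u, v)).2.1) hrow (connProb_le_split p) u

/-- First-moment bound over connected sets. -/
theorem coinMeasure_real_exists_connected_le (hq : 0 < q)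
    (hrow : ∀ u, ∑ v, (p s(u, v) : ℝ) ≤ q) (E : Finset V → (Sym2 V → Prop) → Prop)
    {f : Finset V → ℝ} {M : ℝ}
    (hE : ∀ A : Finset V, (coinMeasure p).real
      {ω | ((coinGraph ω).induce (A : Set V)).Connected ∧ E A ω} ≤ f A * connProb p A)
    (hf : ∀ A, f A * (4 * q) ^ A.card ≤ M) (hM : 0 ≤ M) :
    (coinMeasure p).real {ω | ∃ A : Finset V,
      ((coinGraph ω).induce (A : Set V)).Connected ∧ E A ω} ≤
        Fintype.card V * (M * (2 * q)⁻¹) := by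
  have hsub : {ω | ∃ A : Finset V, ((coinGraph ω).induce (A : Set V)).Connected ∧ E A ω} ⊆
      ⋃ u, ⋃ A ∈ Finset.univ.filter fun A : Finset V => u ∈ A,
        {ω | ((coinGraph ω).induce (A : Set V)).Connected ∧ E A ω} := by
    rintro ω ⟨A, hA, hE⟩
    obtain ⟨u, hu⟩ := hA.nonempty
    simp only [Set.mem_iUnion]
    exact ⟨u, A, by simpa using hu, hA, hE⟩
  refine (measureReal_mono hsub).trans ((measureReal_iUnion_fintype_le _).trans ?_)
  rw [← nsmul_eq_mul, ← Finset.card_univ, ← Finset.sum_const]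
  refine Finset.sum_le_sum fun u _ => (measureReal_biUnion_finset_le _ _).trans ?_
  refine le_trans ?_ (mul_le_mul_of_nonneg_left (sum_connProb_le hq hrow u) hM)
  rw [Finset.mul_sum]
  refine Finset.sum_le_sum fun A _ => (hE A).trans ?_
  rw [← mul_assoc]
  refine mul_le_mul_of_nonneg_right ?_ (connProb_nonneg p A)
  rw [inv_pow, ← div_eq_mul_inv, le_div_iff₀ (by positivity)]
  exact hf A

-- Closed neighbours of `A'` inside `A` number at most `A.card`. The others need coins between `A'`
-- and the complement of `A`, which are independent of the connectedness of `A` and have total mean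
-- at most `q * A'.card`.
open Classical in
theorem coinMeasure_real_connected_closedNbhd_le {A A' : Finset V} (hA : A' ⊆ A)
    (hrow : ∀ u, ∑ v, (p s(u, v) : ℝ) ≤ q) {s b : ℝ} (hs : 0 ≤ s) :
    (coinMeasure p).real {ω | ((coinGraph ω).induce (A : Set V)).Connected ∧
      b ≤ ((coinGraph ω).closedNbhd A').card} ≤
      Real.exp (-s * (b - A.card) + (Real.exp s - 1) * (q * A'.card)) * connProb p A := by
  set F : Finset (Sym2 V) := (A' ×ˢ Aᶜ).image fun x => s(x.1, x.2) with hF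
  have hinj : Set.InjOn (fun x : V × V => s(x.1, x.2)) (A' ×ˢ Aᶜ : Finset (V × V)) := by
    rintro ⟨x, y⟩ h ⟨x', y'⟩ h' heq
    simp only [Finset.coe_product, Finset.coe_compl, Set.mem_prod, Finset.mem_coe,
      Set.mem_compl_iff] at h h'
    simp only [Sym2.eq_iff] at heq
    rcases heq with ⟨rfl, rfl⟩ | ⟨rfl, rfl⟩
    · rfl
    · exact absurd (hA h.1) h'.2
  have hFsum : ∑ e ∈ F, (p e : ℝ) ≤ q * A'.card := by
    rw [hF, Finset.sum_image hinj, Finset.sum_product]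
    calc ∑ x ∈ A', ∑ y ∈ Aᶜ, (p s(x, y) : ℝ) ≤ ∑ x ∈ A', q := by
          refine Finset.sum_le_sum fun x _ => le_trans ?_ (hrow x)
          exact Finset.sum_le_sum_of_subset_of_nonneg (Finset.subset_univ _)
            fun y _ _ => (p s(x, y)).2.1
      _ = q * A'.card := by rw [Finset.sum_const, nsmul_eq_mul, mul_comm]
  have hcount : ∀ ω : Sym2 V → Prop, ((coinGraph ω).closedNbhd A').card ≤
      A.card + (F.filter fun e => ω e).card := by
    intro ω
    have h1 : ((coinGraph ω).closedNbhd A').card ≤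
        A.card + ((coinGraph ω).closedNbhd A' \ A).card := by
      have := Finset.card_le_card_sdiff_add_card (s := (coinGraph ω).closedNbhd A') (t := A)
      omega
    refine h1.trans (Nat.add_le_add_left ?_ _)
    have hex : ∀ v ∈ (coinGraph ω).closedNbhd A' \ A, ∃ x ∈ A', ω s(x, v) := by
      intro v hv
      obtain ⟨hv, hvA⟩ := Finset.mem_sdiff.1 hv
      rcases SimpleGraph.mem_closedNbhd.1 hv with h | ⟨x, hx, hxv⟩
      · exact absurd (hA h) hvA
      · exact ⟨x, hx, (coinGraph_adj.1 hxv).1⟩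
    choose! g hg using hex
    refine Finset.card_le_card_of_injOn (fun v => s(g v, v)) ?_ ?_
    · intro v hv
      have hv' := (Finset.mem_sdiff.1 (Finset.mem_coe.1 hv)).2
      refine Finset.mem_coe.2 (Finset.mem_filter.2 ⟨?_, (hg v hv).2⟩)
      exact Finset.mem_image.2 ⟨(g v, v), by simp [(hg v hv).1, hv'], rfl⟩
    · intro v hv w hw heq
      have h1 : (g v, v) ∈ ((A' ×ˢ Aᶜ : Finset (V × V)) : Set (V × V)) := by
        simp [(hg v hv).1, (Finset.mem_sdiff.1 (Finset.mem_coe.1 hv)).2]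
      have h2 : (g w, w) ∈ ((A' ×ˢ Aᶜ : Finset (V × V)) : Set (V × V)) := by
        simp [(hg w hw).1, (Finset.mem_sdiff.1 (Finset.mem_coe.1 hw)).2]
      exact congrArg Prod.snd (hinj h1 h2 heq)
  have hdisj : Disjoint A.sym2 F := by
    rw [Finset.disjoint_right]
    intro e he heA
    obtain ⟨⟨x, y⟩, hxy, rfl⟩ := Finset.mem_image.1 he
    have h1 := (Finset.mem_product.1 hxy).2
    exact (Finset.mem_compl.1 h1) (Finset.mk_mem_sym2_iff.1 heA).2
  have hdep : DependsOn (fun ω : Sym2 V → Prop =>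
      b - A.card ≤ ((F.filter fun e => ω e).card : ℝ)) (F : Set (Sym2 V)) := by
    intro ω ω' h
    have : (F.filter fun e => ω e) = F.filter fun e => ω' e :=
      Finset.filter_congr fun e he => by rw [h e he]
    simp only [this]
  calc _ ≤ (coinMeasure p).real {ω | ((coinGraph ω).induce (A : Set V)).Connected ∧
        b - A.card ≤ ((F.filter fun e => ω e).card : ℝ)} := by
        refine measureReal_mono ?_
        rintro ω ⟨h1, h2⟩
        refine ⟨h1, ?_⟩
        have : (((coinGraph ω).closedNbhd A').card : ℝ) ≤
          A.card + (F.filter fun e => ω e).card := by exact_mod_cast hcount ω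
        linarith
    _ = connProb p A * (coinMeasure p).real
        {ω | b - A.card ≤ ((F.filter fun e => ω e).card : ℝ)} :=
      coinMeasure_real_and p hdisj (dependsOn_connected A) hdep
    _ ≤ connProb p A * Real.exp (-s * (b - A.card) + (Real.exp s - 1) * (q * A'.card)) :=
      mul_le_mul_of_nonneg_left (coinMeasure_real_card_ge p F hs hFsum) (connProb_nonneg p A)
    _ = _ := mul_comm _ _

end IndependentCoins

/-! ### First-moment bounds -/

section FirstMoment

variable {V : Type*} [Fintype V] [DecidableEq V] {p : Sym2 V → unitInterval} {q : ℝ}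

/-- Large connected sets are unlikely to contain a dense part that expands by a factor `D₁`. -/
theorem coinMeasure_real_expanding_le (hq : 0 < q) (hrow : ∀ u, ∑ v, (p s(u, v) : ℝ) ≤ q)
    {s D₁ T γ κ : ℝ} {L : ℕ} (hs : 0 ≤ s) (hT : 0 < T) (hγ0 : 0 ≤ γ)
    (hγ : γ ≤ s * (D₁ - T) - (Real.exp s - 1) * q) (hκ0 : 0 ≤ κ)
    (hκ : 8 * q * Real.exp (-(γ / T)) ≤ Real.exp (-κ)) :
    (coinMeasure p).real {ω | ∃ A A' : Finset V, ((coinGraph ω).induce (A : Set V)).Connected ∧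
      A' ⊆ A ∧ L ≤ A.card ∧ (A.card : ℝ) ≤ T * A'.card ∧
      D₁ * A'.card ≤ ((coinGraph ω).closedNbhd A').card} ≤
      Fintype.card V * (Real.exp (-(κ * L)) * (2 * q)⁻¹) := by
  have hset : {ω | ∃ A A' : Finset V, ((coinGraph ω).induce (A : Set V)).Connected ∧
      A' ⊆ A ∧ L ≤ A.card ∧ (A.card : ℝ) ≤ T * A'.card ∧
      D₁ * A'.card ≤ ((coinGraph ω).closedNbhd A').card} =
      {ω | ∃ A : Finset V, ((coinGraph ω).induce (A : Set V)).Connected ∧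
        ∃ A' ∈ A.powerset, L ≤ A.card ∧ (A.card : ℝ) ≤ T * A'.card ∧
        D₁ * A'.card ≤ ((coinGraph ω).closedNbhd A').card} := by
    ext ω
    simp only [Set.mem_ofPred_eq, Finset.mem_powerset, exists_and_left]
  rw [hset]
  -- The factor `2 ^ A.card` pays for the choice of `A'`. A Chernoff gain of `γ` per vertex of `A'`
  -- is at least `γ / T` per vertex of `A`.
  refine coinMeasure_real_exists_connected_le hq hrow _
    (f := fun A => if L ≤ A.card then 2 ^ A.card * Real.exp (-(γ / T * A.card)) else 0)
    ?_ ?_ (Real.exp_pos _).le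
  · intro A
    by_cases hL : L ≤ A.card
    · rw [if_pos hL]
      have hsub : {ω | ((coinGraph ω).induce (A : Set V)).Connected ∧
          ∃ A' ∈ A.powerset, L ≤ A.card ∧ (A.card : ℝ) ≤ T * A'.card ∧
          D₁ * A'.card ≤ ((coinGraph ω).closedNbhd A').card} ⊆
          ⋃ A' ∈ A.powerset.filter fun A' => (A.card : ℝ) ≤ T * A'.card,
            {ω | ((coinGraph ω).induce (A : Set V)).Connected ∧
              D₁ * A'.card ≤ ((coinGraph ω).closedNbhd A').card} := by
        rintro ω ⟨h1, A', h2, -, h3, h4⟩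
        simp only [Set.mem_iUnion]
        exact ⟨A', Finset.mem_filter.2 ⟨h2, h3⟩, h1, h4⟩
      refine (measureReal_mono hsub (measure_ne_top _ _)).trans ((measureReal_biUnion_finset_le _ _).trans ?_)
      have hterm : ∀ A' ∈ A.powerset.filter fun A' => (A.card : ℝ) ≤ T * A'.card,
          (coinMeasure p).real {ω | ((coinGraph ω).induce (A : Set V)).Connected ∧
              D₁ * A'.card ≤ ((coinGraph ω).closedNbhd A').card} ≤
            Real.exp (-(γ / T * A.card)) * connProb p A := by
        intro A' hA'
        obtain ⟨h1, h2⟩ := Finset.mem_filter.1 hA'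
        refine (coinMeasure_real_connected_closedNbhd_le (Finset.mem_powerset.1 h1) hrow hs).trans ?_
        refine mul_le_mul_of_nonneg_right (Real.exp_le_exp.2 ?_) (connProb_nonneg p A)
        have h3 : γ / T * A.card ≤ γ * A'.card := by
          rw [div_mul_eq_mul_div, div_le_iff₀ hT]
          nlinarith
        have h4 : (0 : ℝ) ≤ A'.card := by positivity
        have h5 := mul_le_mul_of_nonneg_right hγ h4
        have h6 := mul_le_mul_of_nonneg_left h2 hs
        nlinarith
      refine (Finset.sum_le_sum hterm).trans ?_
      rw [Finset.sum_const, nsmul_eq_mul, mul_assoc]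
      refine mul_le_mul_of_nonneg_right ?_ (mul_nonneg (Real.exp_pos _).le (connProb_nonneg p A))
      have := (Finset.card_filter_le A.powerset fun A' => (A.card : ℝ) ≤ T * A'.card).trans_eq
        (Finset.card_powerset A)
      exact_mod_cast this
    · have : {ω | ((coinGraph ω).induce (A : Set V)).Connected ∧
          ∃ A' ∈ A.powerset, L ≤ A.card ∧ (A.card : ℝ) ≤ T * A'.card ∧
          D₁ * A'.card ≤ ((coinGraph ω).closedNbhd A').card} = ∅ := by
        rw [Set.eq_empty_iff_forall_notMem]
        rintro ω ⟨-, A', -, h, -⟩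
        exact hL h
      rw [this, if_neg hL]
      simp
  · intro A
    by_cases hL : L ≤ A.card
    · simp only [if_pos hL]
      have e1 : Real.exp (-(γ / T * A.card)) = Real.exp (-(γ / T)) ^ A.card := by
        rw [← Real.exp_nat_mul]; congr 1; ring
      calc 2 ^ A.card * Real.exp (-(γ / T * A.card)) * (4 * q) ^ A.card
          = (8 * q * Real.exp (-(γ / T))) ^ A.card := by
            rw [e1, mul_right_comm, ← mul_pow, ← mul_pow]; congr 1; ring
        _ ≤ Real.exp (-κ) ^ A.card := by gcongr
        _ = Real.exp (-(κ * A.card)) := by rw [← Real.exp_nat_mul]; congr 1; ring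
        _ ≤ Real.exp (-(κ * L)) := by
          have : (L : ℝ) ≤ A.card := by exact_mod_cast hL
          gcongr
    · simp only [if_neg hL, zero_mul]
      exact (Real.exp_pos _).le

/-- Small connected sets are unlikely to have many neighbours. -/
theorem coinMeasure_real_small_closedNbhd_le (hq : 1 ≤ 4 * q)
    (hrow : ∀ u, ∑ v, (p s(u, v) : ℝ) ≤ q) {s a b : ℝ} (hs : 0 ≤ s) :
    (coinMeasure p).real {ω | ∃ A : Finset V, ((coinGraph ω).induce (A : Set V)).Connected ∧
      (A.card : ℝ) ≤ a ∧ b ≤ ((coinGraph ω).closedNbhd A).card} ≤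
      Fintype.card V * (Real.exp (a * Real.log (4 * q) - s * (b - a) + (Real.exp s - 1) * (q * a)) *
        (2 * q)⁻¹) := by
  have hq0 : 0 < q := by linarith
  refine coinMeasure_real_exists_connected_le hq0 hrow _
    (f := fun A => if (A.card : ℝ) ≤ a then
      Real.exp (-s * (b - A.card) + (Real.exp s - 1) * (q * A.card)) else 0)
    ?_ ?_ (Real.exp_pos _).le
  · intro A
    by_cases h : (A.card : ℝ) ≤ a
    · rw [if_pos h]
      refine le_trans (measureReal_mono ?_)
        (coinMeasure_real_connected_closedNbhd_le (Finset.Subset.refl A) hrow hs)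
      exact fun ω hω => ⟨hω.1, hω.2.2⟩
    · have : {ω | ((coinGraph ω).induce (A : Set V)).Connected ∧
          (A.card : ℝ) ≤ a ∧ b ≤ ((coinGraph ω).closedNbhd A).card} = ∅ := by
        rw [Set.eq_empty_iff_forall_notMem]
        rintro ω ⟨-, h', -⟩
        exact h h'
      rw [this, if_neg h]
      simp
  · intro A
    by_cases h : (A.card : ℝ) ≤ a
    · simp only [if_pos h]
      have e1 : (4 * q) ^ A.card = Real.exp (A.card * Real.log (4 * q)) := by
        rw [Real.exp_nat_mul, Real.exp_log (by linarith)]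
      rw [e1, ← Real.exp_add]
      refine Real.exp_le_exp.2 ?_
      have h1 := mul_le_mul_of_nonneg_right h (Real.log_nonneg hq)
      have h2 := mul_le_mul_of_nonneg_left h hs
      have h3 : 0 ≤ Real.exp s - 1 := by linarith [Real.add_one_le_exp s]
      have h4 := mul_le_mul_of_nonneg_left (mul_le_mul_of_nonneg_left h hq0.le) h3
      nlinarith
    · simp only [if_neg h, zero_mul]
      exact (Real.exp_pos _).le

/-- Small connected sets are unlikely to have two redundant edges. -/
theorem coinMeasure_real_redundant_le (hq : 1 ≤ 4 * q)
    (hrow : ∀ u, ∑ v, (p s(u, v) : ℝ) ≤ q) {ρ : ℝ} (hρ : ∀ e, (p e : ℝ) ≤ ρ) (m : ℕ) :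
    (coinMeasure p).real {ω | ∃ (A : Finset V) (e f : Sym2 V), A.card ≤ m ∧ e ≠ f ∧
      e ∈ (coinGraph ω).edgeSet ∧ f ∈ (coinGraph ω).edgeSet ∧ (∀ x ∈ e, x ∈ A) ∧
      (∀ x ∈ f, x ∈ A) ∧ (((coinGraph ω).deleteEdges {e, f}).induce (A : Set V)).Connected} ≤
      Fintype.card V * ((m : ℝ) ^ 4 * ρ ^ 2 * (4 * q) ^ m * (2 * q)⁻¹) := by
  have hq0 : 0 < q := by linarith
  set E : Finset V → (Sym2 V → Prop) → Prop := fun A ω => ∃ e f : Sym2 V, A.card ≤ m ∧ e ≠ f ∧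
      e ∈ (coinGraph ω).edgeSet ∧ f ∈ (coinGraph ω).edgeSet ∧ (∀ x ∈ e, x ∈ A) ∧
      (∀ x ∈ f, x ∈ A) ∧ (((coinGraph ω).deleteEdges {e, f}).induce (A : Set V)).Connected with hE
  have hset : {ω | ∃ (A : Finset V) (e f : Sym2 V), A.card ≤ m ∧ e ≠ f ∧
      e ∈ (coinGraph ω).edgeSet ∧ f ∈ (coinGraph ω).edgeSet ∧ (∀ x ∈ e, x ∈ A) ∧
      (∀ x ∈ f, x ∈ A) ∧ (((coinGraph ω).deleteEdges {e, f}).induce (A : Set V)).Connected} ⊆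
      {ω | ∃ A : Finset V, ((coinGraph ω).induce (A : Set V)).Connected ∧ E A ω} := by
    rintro ω ⟨A, e, f, h⟩
    exact ⟨A, SimpleGraph.connected_induce_mono (SimpleGraph.deleteEdges_le _) h.2.2.2.2.2.2, e, f, h⟩
  have hedge : ∀ (ω : Sym2 V → Prop) e, e ∈ (coinGraph ω).edgeSet → ω e := by
    intro ω e he
    induction e with
    | h x y => exact (coinGraph_adj.1 he).1
  have hsym : ∀ A : Finset V, A.card ≤ m → (A.sym2.card : ℝ) ≤ (m : ℝ) ^ 2 := by
    intro A hA
    rw [Finset.card_sym2]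
    have h1 : (A.card + 1).choose 2 ≤ A.card ^ 2 := by
      rw [Nat.choose_two_right, Nat.add_sub_cancel]
      refine Nat.div_le_of_le_mul ?_
      nlinarith [Nat.zero_le A.card, Nat.le_self_pow two_ne_zero A.card]
    exact_mod_cast h1.trans (Nat.pow_le_pow_left hA 2)
  refine (measureReal_mono hset).trans ?_
  -- `m ^ 4` pays for the choice of the two edges and `ρ ^ 2` for their presence, which is
  -- independent of connectedness without them.
  refine coinMeasure_real_exists_connected_le hq0 hrow E
    (f := fun A => if A.card ≤ m then (m : ℝ) ^ 4 * ρ ^ 2 else 0) ?_ ?_ (by positivity)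
  · intro A
    by_cases hA : A.card ≤ m
    · rw [if_pos hA]
      have hsub : {ω | ((coinGraph ω).induce (A : Set V)).Connected ∧ E A ω} ⊆
          ⋃ x ∈ (A.sym2 ×ˢ A.sym2).filter fun x => x.1 ≠ x.2,
            {ω : Sym2 V → Prop | ω x.1 ∧ ω x.2 ∧ (((coinGraph ω).deleteEdges
              (({x.1, x.2} : Finset (Sym2 V)) : Set (Sym2 V))).induce (A : Set V)).Connected} := by
        rintro ω ⟨-, e, f, -, h1, h2, h3, h4, h5, h6⟩
        simp only [Set.mem_iUnion]
        refine ⟨(e, f), Finset.mem_filter.2 ⟨Finset.mem_product.2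
          ⟨Finset.mem_sym2_iff.2 h4, Finset.mem_sym2_iff.2 h5⟩, h1⟩, hedge ω e h2, hedge ω f h3, ?_⟩
        simpa using h6
      refine (measureReal_mono hsub (measure_ne_top _ _)).trans ((measureReal_biUnion_finset_le _ _).trans ?_)
      have hterm : ∀ x ∈ (A.sym2 ×ˢ A.sym2).filter fun x => x.1 ≠ x.2, (coinMeasure p).real
            {ω : Sym2 V → Prop | ω x.1 ∧ ω x.2 ∧ (((coinGraph ω).deleteEdges
              (({x.1, x.2} : Finset (Sym2 V)) : Set (Sym2 V))).induce (A : Set V)).Connected} ≤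
            ρ ^ 2 * connProb p A := by
        rintro ⟨e, f⟩ hx
        have hef : e ≠ f := (Finset.mem_filter.1 hx).2
        have hdep : DependsOn (fun ω : Sym2 V → Prop => ω f ∧ (((coinGraph ω).deleteEdges
              (({e, f} : Finset (Sym2 V)) : Set (Sym2 V))).induce (A : Set V)).Connected)
            (({f} ∪ (A.sym2 \ {e, f}) : Finset (Sym2 V)) : Set (Sym2 V)) := by
          intro ω ω' h
          have e1 := dependsOn_coin f (x := ω) (y := ω') fun i hi => h i (by
            rw [Finset.coe_union]; exact Or.inl hi)
          have e2 := dependsOn_connected_deleteEdges A {e, f} (x := ω) (y := ω') fun i hi => h i (by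
            rw [Finset.coe_union]; exact Or.inr hi)
          simp only at e1 e2
          simp only [e1, e2]
        rw [coinMeasure_real_and p (S := {e}) ?_ (dependsOn_coin e) hdep,
          coinMeasure_real_and p (S := {f}) (T := A.sym2 \ {e, f}) ?_ (dependsOn_coin f)
            (dependsOn_connected_deleteEdges A {e, f}),
          coinMeasure_real_coin, coinMeasure_real_coin, ← mul_assoc, sq]
        · have h0 : ∀ e, (0 : ℝ) ≤ p e := fun e => (p e).2.1
          refine mul_le_mul (mul_le_mul (hρ e) (hρ f) (h0 f) ((h0 e).trans (hρ e)))
            (measureReal_mono fun ω hω => ?_) measureReal_nonneg (mul_self_nonneg ρ)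
          exact SimpleGraph.connected_induce_mono (SimpleGraph.deleteEdges_le _) hω
        · simp
        · simp [hef]
      refine (Finset.sum_le_sum hterm).trans ?_
      rw [Finset.sum_const, nsmul_eq_mul, mul_assoc]
      refine mul_le_mul_of_nonneg_right ?_ (mul_nonneg (sq_nonneg ρ) (connProb_nonneg p A))
      have h1 := Finset.card_filter_le (A.sym2 ×ˢ A.sym2) fun x => x.1 ≠ x.2
      rw [Finset.card_product] at h1
      have h2 : (((A.sym2 ×ˢ A.sym2).filter fun x => x.1 ≠ x.2).card : ℝ) ≤
          A.sym2.card * A.sym2.card := by exact_mod_cast h1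
      calc _ ≤ _ := h2
        _ ≤ (m : ℝ) ^ 2 * (m : ℝ) ^ 2 := by gcongr <;> exact hsym A hA
        _ = _ := by ring
    · have : {ω | ((coinGraph ω).induce (A : Set V)).Connected ∧ E A ω} = ∅ := by
        rw [Set.eq_empty_iff_forall_notMem]
        rintro ω ⟨-, e, f, h, -⟩
        exact hA h
      rw [this, if_neg hA]
      simp
  · intro A
    by_cases hA : A.card ≤ m
    · simp only [if_pos hA]
      gcongr
    · simp only [if_neg hA, zero_mul]
      positivity

end FirstMoment

/-! ### Events likely uniformly over sparse independent-edge models -/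

/-- The graph property `E` holds with probability tending to one, uniformly over all models with
independent edges whose expected degrees are at most `q` and whose edge probabilities are at most
`c / n`. -/
def UniformlyLikely (q c : ℝ) (E : ∀ n, SimpleGraph (Fin n) → Prop) : Prop :=
  ∀ η > 0, ∀ᶠ n : ℕ in atTop, ∀ p : Sym2 (Fin n) → unitInterval,
    (∀ u, ∑ v, (p s(u, v) : ℝ) ≤ q) → (∀ e, (p e : ℝ) ≤ c / n) →
      (coinMeasure p).real {ω | ¬ E n (coinGraph ω)} ≤ η

namespace UniformlyLikely

variable {q c : ℝ} {E F : ∀ n, SimpleGraph (Fin n) → Prop}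

theorem of_bound {f : ℕ → ℝ} (hf : Tendsto f atTop (𝓝 0))
    (h : ∀ᶠ n : ℕ in atTop, ∀ p : Sym2 (Fin n) → unitInterval,
      (∀ u, ∑ v, (p s(u, v) : ℝ) ≤ q) → (∀ e, (p e : ℝ) ≤ c / n) →
        (coinMeasure p).real {ω | ¬ E n (coinGraph ω)} ≤ f n) : UniformlyLikely q c E := by
  intro η hη
  filter_upwards [h, hf.eventually (gt_mem_nhds hη)] with n h1 h2 p hp1 hp2
  exact (h1 p hp1 hp2).trans h2.le

theorem mono (hE : UniformlyLikely q c E) (h : ∀ᶠ n in atTop, ∀ G, E n G → F n G) :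
    UniformlyLikely q c F := by
  intro η hη
  filter_upwards [hE η hη, h] with n h1 h2 p hp1 hp2
  have hsub : {ω | ¬ F n (coinGraph ω)} ⊆ {ω | ¬ E n (coinGraph ω)} :=
    fun ω hω hE => hω (h2 _ hE)
  exact (measureReal_mono hsub).trans (h1 p hp1 hp2)

theorem and (hE : UniformlyLikely q c E) (hF : UniformlyLikely q c F) :
    UniformlyLikely q c fun n G => E n G ∧ F n G := by
  intro η hη
  filter_upwards [hE (η / 2) (half_pos hη), hF (η / 2) (half_pos hη)] with n h1 h2 p hp1 hp2
  have hsub : {ω | ¬ (E n (coinGraph ω) ∧ F n (coinGraph ω))} ⊆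
      {ω | ¬ E n (coinGraph ω)} ∪ {ω | ¬ F n (coinGraph ω)} := by
    intro ω hω
    by_cases h : E n (coinGraph ω)
    · exact Or.inr fun hF => hω ⟨h, hF⟩
    · exact Or.inl h
  refine (measureReal_mono hsub).trans ((measureReal_union_le _ _).trans ?_)
  linarith [h1 p hp1 hp2, h2 p hp1 hp2]

theorem forall_lt {E : ℕ → ∀ n, SimpleGraph (Fin n) → Prop} (R : ℕ)
    (h : ∀ j < R, UniformlyLikely q c (E j)) :
    UniformlyLikely q c fun n G => ∀ j < R, E j n G := by
  induction R with
  | zero =>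
    intro η hη
    filter_upwards with n p _ _
    simpa using hη.le
  | succ R ih =>
    refine ((ih fun j hj => h j (by omega)).and (h R (by omega))).mono (.of_forall ?_)
    intro n G hG j hj
    rcases Nat.lt_succ_iff_lt_or_eq.1 hj with h | rfl
    · exact hG.1 j h
    · exact hG.2

/-- First-moment bounds carry a factor `n` for the anchor vertex, so an exponent `-2 log n` is
enough. -/
theorem tendsto_card_mul_exp (q : ℝ) :
    Tendsto (fun n : ℕ => (n : ℝ) * (Real.exp (-2 * Real.log n) * (2 * q)⁻¹)) atTop (𝓝 0) := by
  have h : Tendsto (fun n : ℕ => (n : ℝ)⁻¹ * (2 * q)⁻¹) atTop (𝓝 0) := by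
    simpa using (tendsto_inv_atTop_nhds_zero_nat (𝕜 := ℝ)).mul_const ((2 * q)⁻¹)
  refine h.congr' ?_
  filter_upwards [eventually_gt_atTop 0] with n hn
  have hn' : (0 : ℝ) < n := by exact_mod_cast hn
  have : Real.exp (-2 * Real.log n) = (n : ℝ)⁻¹ * (n : ℝ)⁻¹ := by
    rw [show -2 * Real.log n = -Real.log n + -Real.log n by ring, Real.exp_add, Real.exp_neg,
      Real.exp_log hn']
  rw [this]
  field_simp

theorem small_closedNbhd (hq : 1 ≤ 4 * q) {s α β : ℝ} (hs : 0 ≤ s)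
    (h : α * Real.log (4 * q) - s * (β - α) + (Real.exp s - 1) * (q * α) ≤ -2) :
    UniformlyLikely q c fun n G => ∀ A : Finset (Fin n), (G.induce (A : Set (Fin n))).Connected →
      (A.card : ℝ) ≤ α * Real.log n → ((G.closedNbhd A).card : ℝ) ≤ β * Real.log n := by
  refine of_bound (tendsto_card_mul_exp q) ?_
  filter_upwards [eventually_gt_atTop 0] with n hn p hp1 _
  have hlog : 0 ≤ Real.log n := Real.log_natCast_nonneg n
  have hsub : {ω : Sym2 (Fin n) → Prop | ¬ ∀ A : Finset (Fin n),
      ((coinGraph ω).induce (A : Set (Fin n))).Connected → (A.card : ℝ) ≤ α * Real.log n →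
        (((coinGraph ω).closedNbhd A).card : ℝ) ≤ β * Real.log n} ⊆
      {ω | ∃ A : Finset (Fin n), ((coinGraph ω).induce (A : Set (Fin n))).Connected ∧
        (A.card : ℝ) ≤ α * Real.log n ∧ β * Real.log n ≤ ((coinGraph ω).closedNbhd A).card} := by
    intro ω hω
    simp only [Set.mem_ofPred_eq] at hω
    push Not at hω
    obtain ⟨A, h1, h2, h3⟩ := hω
    exact ⟨A, h1, h2, h3.le⟩
  refine (measureReal_mono hsub).trans
    ((coinMeasure_real_small_closedNbhd_le hq hp1 hs).trans ?_)
  rw [Fintype.card_fin]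
  have hq0 : 0 < q := by linarith
  gcongr
  have := mul_le_mul_of_nonneg_right h hlog
  linarith

/-- A steep tilt makes even `β log n` neighbours costly, provided `α` is small enough. Iterated
backwards, this keeps balls below `δ log n` for boundedly many steps. -/
theorem exists_small_closedNbhd (hq : 1 ≤ 4 * q) {β : ℝ} (hβ : 0 < β) :
    ∃ α, 0 < α ∧ α ≤ β ∧
      UniformlyLikely q c fun n G => ∀ A : Finset (Fin n), (G.induce (A : Set (Fin n))).Connected →
        (A.card : ℝ) ≤ α * Real.log n → ((G.closedNbhd A).card : ℝ) ≤ β * Real.log n := by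
  -- With `s * β = 4`, the condition `α * B ≤ 2` leaves an exponent of at most `-2`.
  set s : ℝ := 4 / β with hs
  have hs0 : 0 < s := by positivity
  have hq0 : 0 < q := by linarith
  set B : ℝ := Real.log (4 * q) + s + (Real.exp s - 1) * q with hB
  have hB0 : 0 < B := by
    have h1 := Real.log_nonneg hq
    have h2 : 0 ≤ Real.exp s - 1 := by linarith [Real.add_one_le_exp s]
    have h3 := mul_nonneg h2 hq0.le
    linarith
  refine ⟨min β (2 / B), by positivity, min_le_left _ _, small_closedNbhd hq hs0.le ?_⟩
  have h1 : min β (2 / B) * B ≤ 2 := by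
    calc min β (2 / B) * B ≤ 2 / B * B := by gcongr; exact min_le_right _ _
      _ = 2 := by field_simp
  have h2 : s * β = 4 := by rw [hs]; field_simp
  rw [hB] at h1
  nlinarith

theorem exists_closedNbhd_le (hq : 1 ≤ 4 * q) (α : ℝ) :
    ∃ β, UniformlyLikely q c fun n G => ∀ A : Finset (Fin n),
      (G.induce (A : Set (Fin n))).Connected →
        (A.card : ℝ) ≤ α * Real.log n → ((G.closedNbhd A).card : ℝ) ≤ β * Real.log n := by
  refine ⟨α * (Real.log (4 * q) + 1 + (Real.exp 1 - 1) * q) + 2,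
    small_closedNbhd hq zero_le_one (le_of_eq ?_)⟩
  ring

theorem not_expanding (hq : 0 < q) {s D₁ T γ κ K : ℝ} (hs : 0 ≤ s) (hT : 0 < T) (hγ0 : 0 ≤ γ)
    (hγ : γ ≤ s * (D₁ - T) - (Real.exp s - 1) * q) (hκ0 : 0 ≤ κ)
    (hκ : 8 * q * Real.exp (-(γ / T)) ≤ Real.exp (-κ)) (hK : 2 ≤ κ * K) :
    UniformlyLikely q c fun n G => ∀ A A' : Finset (Fin n),
      (G.induce (A : Set (Fin n))).Connected → A' ⊆ A → ⌈K * Real.log n⌉₊ ≤ A.card →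
      (A.card : ℝ) ≤ T * A'.card → ((G.closedNbhd A').card : ℝ) < D₁ * A'.card := by
  refine of_bound (tendsto_card_mul_exp q) (.of_forall fun n p hp1 _ => ?_)
  have hsub : {ω : Sym2 (Fin n) → Prop | ¬ ∀ A A' : Finset (Fin n),
      ((coinGraph ω).induce (A : Set (Fin n))).Connected → A' ⊆ A → ⌈K * Real.log n⌉₊ ≤ A.card →
      (A.card : ℝ) ≤ T * A'.card → (((coinGraph ω).closedNbhd A').card : ℝ) < D₁ * A'.card} ⊆
      {ω | ∃ A A' : Finset (Fin n), ((coinGraph ω).induce (A : Set (Fin n))).Connected ∧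
        A' ⊆ A ∧ ⌈K * Real.log n⌉₊ ≤ A.card ∧ (A.card : ℝ) ≤ T * A'.card ∧
        D₁ * A'.card ≤ ((coinGraph ω).closedNbhd A').card} := by
    intro ω hω
    simp only [Set.mem_ofPred_eq] at hω
    push Not at hω
    exact hω
  refine (measureReal_mono hsub).trans
    ((coinMeasure_real_expanding_le hq hp1 hs hT hγ0 hγ hκ0 hκ).trans ?_)
  rw [Fintype.card_fin]
  gcongr
  have h1 : K * Real.log n ≤ (⌈K * Real.log n⌉₊ : ℝ) := Nat.le_ceil _
  have h2 := mul_le_mul_of_nonneg_left h1 hκ0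
  have h3 := mul_le_mul_of_nonneg_right hK (Real.log_natCast_nonneg n)
  nlinarith

/-- The smallness of `K` makes `(4q)^(4L)` of order at most `n^(1/2)`. Against the factor `n` and
the cost `(c / n)²` of two edges, the bound is of order `(log n)^4 / n^(1/2)`. -/
theorem not_redundant (hq : 1 ≤ 4 * q) {K : ℝ} (hK0 : 0 ≤ K)
    (hK : 4 * K * Real.log (4 * q) ≤ 1 / 2) :
    UniformlyLikely q c fun n G => ∀ (A : Finset (Fin n)) (e f : Sym2 (Fin n)),
      A.card ≤ 4 * ⌈K * Real.log n⌉₊ → e ≠ f → e ∈ G.edgeSet → f ∈ G.edgeSet →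
      (∀ x ∈ e, x ∈ A) → (∀ x ∈ f, x ∈ A) →
      ¬ ((G.deleteEdges {e, f}).induce (A : Set (Fin n))).Connected := by
  have hq0 : 0 < q := by linarith
  set C : ℝ := (4 * (K + 1)) ^ 4 * c ^ 2 * (4 * q) ^ 4 * (2 * q)⁻¹ with hC
  have hlim : Tendsto (fun n : ℕ => C * (Real.log n ^ 4 / (n : ℝ) ^ (1 / 2 : ℝ))) atTop (𝓝 0) := by
    have h1 : Tendsto (fun x : ℝ => Real.log x ^ 4 / x ^ (1 / 2 : ℝ)) atTop (𝓝 0) := by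
      have := (isLittleO_log_rpow_rpow_atTop (4 : ℝ) (by norm_num : (0 : ℝ) < 1 / 2)).tendsto_div_nhds_zero
      refine this.congr fun x => ?_
      norm_cast
    simpa using (h1.comp tendsto_natCast_atTop_atTop).const_mul C
  refine of_bound hlim ?_
  filter_upwards [eventually_ge_atTop 3] with n hn p hp1 hp2
  have hn0 : (0 : ℝ) < n := by positivity
  have hlog1 : 1 ≤ Real.log n := by
    rw [Real.le_log_iff_exp_le hn0]
    have : (3 : ℝ) ≤ n := by exact_mod_cast hn
    linarith [Real.exp_one_lt_d9]
  set m : ℕ := 4 * ⌈K * Real.log n⌉₊ with hm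
  have hmle : (m : ℝ) ≤ 4 * (K * Real.log n + 1) := by
    rw [hm]; push_cast
    have := Nat.ceil_lt_add_one (mul_nonneg hK0 (by linarith : 0 ≤ Real.log n))
    linarith
  have hmle' : (m : ℝ) ≤ 4 * (K + 1) * Real.log n := by nlinarith
  have hpow : (4 * q) ^ m ≤ (4 * q) ^ 4 * (n : ℝ) ^ (1 / 2 : ℝ) := by
    have e1 : (4 * q) ^ m = Real.exp (m * Real.log (4 * q)) := by
      rw [Real.exp_nat_mul, Real.exp_log (by linarith)]
    have e2 : (4 * q) ^ 4 = Real.exp (4 * Real.log (4 * q)) := by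
      rw [show (4 : ℝ) * Real.log (4 * q) = (4 : ℕ) * Real.log (4 * q) by norm_num,
        Real.exp_nat_mul, Real.exp_log (by linarith)]
    rw [e1, e2, Real.rpow_def_of_pos hn0, ← Real.exp_add]
    refine Real.exp_le_exp.2 ?_
    have h1 := mul_le_mul_of_nonneg_right hmle (Real.log_nonneg hq)
    have h2 := mul_le_mul_of_nonneg_left hK (by linarith : 0 ≤ Real.log n)
    nlinarith
  have hsub : {ω : Sym2 (Fin n) → Prop | ¬ ∀ (A : Finset (Fin n)) (e f : Sym2 (Fin n)),
      A.card ≤ m → e ≠ f → e ∈ (coinGraph ω).edgeSet →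
      f ∈ (coinGraph ω).edgeSet → (∀ x ∈ e, x ∈ A) → (∀ x ∈ f, x ∈ A) →
      ¬ (((coinGraph ω).deleteEdges {e, f}).induce (A : Set (Fin n))).Connected} ⊆
      {ω | ∃ (A : Finset (Fin n)) (e f : Sym2 (Fin n)), A.card ≤ m ∧ e ≠ f ∧
      e ∈ (coinGraph ω).edgeSet ∧ f ∈ (coinGraph ω).edgeSet ∧ (∀ x ∈ e, x ∈ A) ∧
      (∀ x ∈ f, x ∈ A) ∧
      (((coinGraph ω).deleteEdges {e, f}).induce (A : Set (Fin n))).Connected} := by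
    intro ω hω
    simp only [Set.mem_ofPred_eq] at hω
    push Not at hω
    exact hω
  refine (measureReal_mono hsub).trans ((coinMeasure_real_redundant_le hq hp1 hp2 m).trans ?_)
  rw [Fintype.card_fin]
  have hsq : (n : ℝ) ^ (1 / 2 : ℝ) * (n : ℝ) ^ (1 / 2 : ℝ) = n := by
    rw [← Real.rpow_add hn0]; norm_num
  have hs0 : 0 < (n : ℝ) ^ (1 / 2 : ℝ) := by positivity
  calc (n : ℝ) * ((m : ℝ) ^ 4 * (c / n) ^ 2 * (4 * q) ^ m * (2 * q)⁻¹)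
      ≤ n * ((4 * (K + 1) * Real.log n) ^ 4 * (c / n) ^ 2 *
          ((4 * q) ^ 4 * (n : ℝ) ^ (1 / 2 : ℝ)) * (2 * q)⁻¹) := by gcongr
    _ = C * (Real.log n ^ 4 * ((n : ℝ) ^ (1 / 2 : ℝ) / n)) := by
      rw [hC]; field_simp
    _ = C * (Real.log n ^ 4 / (n : ℝ) ^ (1 / 2 : ℝ)) := by
      congr 1
      rw [div_eq_mul_inv (Real.log n ^ 4)]
      congr 1
      nth_rewrite 2 [← hsq]
      field_simp

end UniformlyLikely

/-! ### The decomposition for independent edges -/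

/-- The graph `G` splits into a part of degree at most `D` and a `(Δ, D)`-pseudorandom
near-forest. -/
def SimpleGraph.HasDecomposition {V : Type*} (G : SimpleGraph V) (Δ D : ℝ) : Prop :=
  ∃ G₁ G₂ : SimpleGraph V, G₁.edgeSet ∪ G₂.edgeSet = G.edgeSet ∧
    Disjoint G₁.edgeSet G₂.edgeSet ∧ (∀ v, ((G₁.neighborSet v).ncard : ℝ) ≤ D) ∧
    G₂.IsNearForest ∧ G₂.IsPseudorandom Δ D (G₁.support ∩ G₂.support)

/-- The threshold `K log n` must satisfy two opposite demands: large enough to exclude expanding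
sets (`hK`), small enough to exclude redundant edges (`hK'`). -/
theorem uniformlyLikely_hasDecomposition {q c D D₁ θ T s γ κ K : ℝ} (hq : 1 ≤ q)
    (hD1 : 1 < D) (hD₁ : 2 ≤ D₁) (hθ : 0 < θ) (hθ1 : θ < 1) (hD : D₁ * Real.exp (2 * θ) ≤ D)
    (hT : 21 ≤ θ * T) (hs : 0 ≤ s) (hγ0 : 0 ≤ γ)
    (hγ : γ ≤ s * (D₁ - T) - (Real.exp s - 1) * q) (hκ0 : 0 ≤ κ)
    (hκ : 8 * q * Real.exp (-(γ / T)) ≤ Real.exp (-κ)) (hK0 : 0 < K) (hK : 2 ≤ κ * K)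
    (hK' : 4 * K * Real.log (4 * q) ≤ 1 / 2) {δ : ℝ} (hδ : 0 < δ) :
    UniformlyLikely q c fun n G => G.HasDecomposition (δ * Real.log n) D := by
  have hq4 : 1 ≤ 4 * q := by linarith
  have hT1 : 1 ≤ T := by nlinarith
  have hD₁D : D₁ ≤ D := by
    have h1 : 1 ≤ Real.exp (2 * θ) := Real.one_le_exp (by linarith)
    nlinarith
  obtain ⟨K', hK'l⟩ := UniformlyLikely.exists_closedNbhd_le (c := c) hq4 K
  obtain ⟨R, hR⟩ := pow_unbounded_of_one_lt (K' / δ) hD1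
  have hstep : ∀ β : ℝ, ∃ α, 0 < β → 0 < α ∧ α ≤ β ∧
      UniformlyLikely q c fun n G => ∀ A : Finset (Fin n), (G.induce (A : Set (Fin n))).Connected →
        (A.card : ℝ) ≤ α * Real.log n → ((G.closedNbhd A).card : ℝ) ≤ β * Real.log n := by
    intro β
    by_cases hβ : 0 < β
    · obtain ⟨α, h⟩ := UniformlyLikely.exists_small_closedNbhd (c := c) hq4 hβ
      exact ⟨α, fun _ => h⟩
    · exact ⟨0, fun h => absurd h hβ⟩
  choose g hg using hstep
  have hiter : ∀ k : ℕ, 0 < g^[k] δ ∧ g^[k] δ ≤ δ := by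
    intro k
    induction k with
    | zero => exact ⟨hδ, le_rfl⟩
    | succ k ih =>
      rw [Function.iterate_succ_apply']
      exact ⟨(hg _ ih.1).1, (hg _ ih.1).2.1.trans ih.2⟩
  -- Thresholds are built backwards from `α (R + 1) = δ`, each small enough that one step from it
  -- stays below the next.
  set α : ℕ → ℝ := fun j => g^[R + 1 - j] δ with hα
  have hslow : UniformlyLikely q c fun n G => ∀ j < R + 1, ∀ A : Finset (Fin n),
      (G.induce (A : Set (Fin n))).Connected → (A.card : ℝ) ≤ α j * Real.log n →
        ((G.closedNbhd A).card : ℝ) ≤ α (j + 1) * Real.log n := by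
    refine UniformlyLikely.forall_lt (R + 1) fun j hj => ?_
    have : α j = g (α (j + 1)) := by
      simp only [hα]
      rw [← Function.iterate_succ_apply' g, show R + 1 - j = (R + 1 - (j + 1)).succ by omega]
    rw [this]
    exact (hg _ (hiter _).1).2.2
  have hexp := UniformlyLikely.not_expanding (c := c) (by linarith) hs (by linarith) hγ0 hγ hκ0 hκ hK
  have hcyc := UniformlyLikely.not_redundant (c := c) hq4 hK0.le hK'
  refine ((hslow.and hK'l).and (hexp.and hcyc)).mono ?_
  have hloglim : Tendsto (fun n : ℕ => Real.log n) atTop atTop :=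
    Real.tendsto_log_atTop.comp tendsto_natCast_atTop_atTop
  filter_upwards [hloglim.eventually_ge_atTop (1 / α 0), hloglim.eventually_gt_atTop 0]
    with n hn hlog G hG
  obtain ⟨⟨h1, h2⟩, h3, h4⟩ := hG
  have hα0 : 0 < α 0 := (hiter _).1
  refine SimpleGraph.exists_decomposition hD1.le hD₁ hθ hθ1 hD hT
    (Nat.one_le_ceil_iff.2 (mul_pos hK0 hlog)) h3 h4 ?_
  refine SimpleGraph.card_ballFinset_le (K := K') (L := ⌈K * Real.log n⌉₊) (R := R) α hD1.le hlog.le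
    hδ.le ?_ (fun j _ => (hiter _).2) (fun j hj => h1 j (by omega)) ?_ ?_ ?_
  · rw [div_le_iff₀ hα0] at hn
    linarith
  · intro A hA hAL
    exact h2 A hA (Nat.lt_ceil.1 hAL).le
  · intro A hA hAL
    have := h3 A A hA (Finset.Subset.refl A) hAL (le_mul_of_one_le_left (by positivity) hT1)
    exact this.le.trans (by gcongr)
  · rw [div_lt_iff₀ hδ] at hR
    exact hR.le

/-! ### Balanced labels and expected degrees in the block model -/

section Balance

variable {n : ℕ}

/-- The sum of the community labels. -/
def labelSum (σ : Fin n → ℤˣ) : ℝ := ∑ v, ((σ v : ℤ) : ℝ)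

theorem unit_mul_self_cast (a : ℤˣ) : ((a : ℤ) : ℝ) * ((a : ℤ) : ℝ) = 1 := by
  rcases Int.units_eq_one_or a with h | h <;> simp [h]

/-- Flipping the label of `u` is a bijection that negates the summand. -/
theorem sum_label_mul_label {u v : Fin n} (huv : u ≠ v) :
    ∑ σ : Fin n → ℤˣ, ((σ u : ℤ) : ℝ) * ((σ v : ℤ) : ℝ) = 0 := by
  have hinv : Function.Involutive fun σ : Fin n → ℤˣ => Function.update σ u (-σ u) := by
    intro σ
    simp
  have h := Equiv.sum_comp hinv.toPerm fun σ : Fin n → ℤˣ => ((σ u : ℤ) : ℝ) * ((σ v : ℤ) : ℝ)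
  simp only [Function.Involutive.coe_toPerm, Function.update_self,
    Function.update_of_ne huv.symm, Units.val_neg, Int.cast_neg, neg_mul,
    Finset.sum_neg_distrib] at h
  linarith

theorem sum_labelSum_sq : ∑ σ : Fin n → ℤˣ, labelSum σ ^ 2 = n * 2 ^ n := by
  have h1 : ∀ σ : Fin n → ℤˣ, labelSum σ ^ 2 =
      ∑ u, ∑ v, ((σ u : ℤ) : ℝ) * ((σ v : ℤ) : ℝ) := by
    intro σ
    rw [sq, labelSum, Finset.sum_mul_sum]
  simp only [h1]
  rw [Finset.sum_comm]
  have h2 : ∀ u : Fin n, ∑ σ : Fin n → ℤˣ, ∑ v, ((σ u : ℤ) : ℝ) * ((σ v : ℤ) : ℝ) = 2 ^ n := by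
    intro u
    rw [Finset.sum_comm, Finset.sum_eq_single u]
    · simp [unit_mul_self_cast]
    · intro v _ hv
      exact sum_label_mul_label hv.symm
    · simp
  simp [h2]

/-- Most label vectors are balanced, by Chebyshev's inequality. -/
theorem card_unbalanced_le {a : ℝ} (ha : 0 < a) :
    ((Finset.univ.filter fun σ : Fin n → ℤˣ => a < |labelSum σ|).card : ℝ) * a ^ 2 ≤
      n * 2 ^ n := by
  rw [← sum_labelSum_sq, ← nsmul_eq_mul, ← Finset.sum_const]
  refine le_trans (Finset.sum_le_sum fun σ hσ => ?_)
    (Finset.sum_le_sum_of_subset_of_nonneg (Finset.subset_univ _) fun σ _ _ => sq_nonneg _)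
  have h := (Finset.mem_filter.1 hσ).2
  rw [← sq_abs (labelSum σ)]
  gcongr

variable {d lam : ℝ}

/-- Being affine in the product of the labels, the probabilities at `u` sum to an expression in
`labelSum σ`. -/
theorem sbmEdgeProb_mk (hd : 0 ≤ d) (hlam : |lam| ≤ √d) (hn : 2 * d ≤ n) (hn0 : 0 < n)
    (σ : Fin n → ℤˣ) (u v : Fin n) :
    (sbmEdgeProb n d lam σ s(u, v) : ℝ) =
      d / n + lam * √d / n * (((σ u : ℤ) : ℝ) * ((σ v : ℤ) : ℝ)) := by
  have hn' : (0 : ℝ) < n := by exact_mod_cast hn0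
  have hld : |lam * √d| ≤ d := by
    rw [abs_mul, abs_of_nonneg (Real.sqrt_nonneg d)]
    calc |lam| * √d ≤ √d * √d := by gcongr
      _ = d := Real.mul_self_sqrt hd
  obtain ⟨h1, h2⟩ := abs_le.1 hld
  have hmem : ∀ y : ℝ, |y| ≤ d → (d + y) / n ∈ Set.Icc (0 : ℝ) 1 := by
    intro y hy
    obtain ⟨h1, h2⟩ := abs_le.1 hy
    exact ⟨div_nonneg (by linarith) hn'.le, (div_le_one hn').2 (by linarith)⟩
  simp only [sbmEdgeProb, Sym2.lift_mk]
  by_cases h : σ u = σ v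
  · rw [if_pos h, Set.projIcc_of_mem _ (hmem _ hld), h, unit_mul_self_cast]
    ring
  · rw [if_neg h]
    have hm := hmem (-(lam * √d)) (by rwa [abs_neg])
    rw [← sub_eq_add_neg] at hm
    rw [Set.projIcc_of_mem _ hm]
    have hneg : ((σ u : ℤ) : ℝ) * ((σ v : ℤ) : ℝ) = -1 := by
      rcases Int.units_eq_one_or (σ u) with hu | hu <;>
        rcases Int.units_eq_one_or (σ v) with hv | hv <;> simp_all
    rw [hneg]
    ring

theorem sbmEdgeProb_le (hd : 0 ≤ d) (hlam : |lam| ≤ √d) (hn : 2 * d ≤ n) (hn0 : 0 < n)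
    (σ : Fin n → ℤˣ) (e : Sym2 (Fin n)) : (sbmEdgeProb n d lam σ e : ℝ) ≤ 2 * d / n := by
  induction e with
  | h u v =>
    rw [sbmEdgeProb_mk hd hlam hn hn0]
    have hn' : (0 : ℝ) < n := by exact_mod_cast hn0
    have hld : |lam * √d * (((σ u : ℤ) : ℝ) * ((σ v : ℤ) : ℝ))| ≤ d := by
      have h1 : |((σ u : ℤ) : ℝ) * ((σ v : ℤ) : ℝ)| = 1 := by
        rcases Int.units_eq_one_or (σ u) with hu | hu <;>
          rcases Int.units_eq_one_or (σ v) with hv | hv <;> simp [hu, hv]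
      rw [abs_mul, h1, mul_one, abs_mul, abs_of_nonneg (Real.sqrt_nonneg d)]
      calc |lam| * √d ≤ √d * √d := by gcongr
        _ = d := Real.mul_self_sqrt hd
    rw [div_mul_eq_mul_div, ← add_div]
    gcongr
    linarith [(abs_le.1 hld).2]

/-- The deviation from `d` is at most `d / n * |labelSum σ|`, which balance makes at most 1. -/
theorem sum_sbmEdgeProb_le (hd : 0 < d) (hlam : |lam| ≤ √d) (hn : 2 * d ≤ n) (hn0 : 0 < n)
    {σ : Fin n → ℤˣ} (hσ : |labelSum σ| ≤ n / d) (u : Fin n) :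
    ∑ v, (sbmEdgeProb n d lam σ s(u, v) : ℝ) ≤ d + 1 := by
  have hn' : (0 : ℝ) < n := by exact_mod_cast hn0
  simp only [sbmEdgeProb_mk hd.le hlam hn hn0]
  rw [Finset.sum_add_distrib, ← Finset.mul_sum, ← Finset.mul_sum]
  simp only [Finset.sum_const, Finset.card_univ, Fintype.card_fin, nsmul_eq_mul]
  have h1 : (n : ℝ) * (d / n) = d := by field_simp
  rw [h1]
  have h2 : |lam * √d / n * (((σ u : ℤ) : ℝ) * labelSum σ)| ≤ 1 := by
    have hu : |((σ u : ℤ) : ℝ)| = 1 := by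
      rcases Int.units_eq_one_or (σ u) with hu | hu <;> simp [hu]
    rw [abs_mul, abs_mul, hu, one_mul, abs_div, abs_of_pos hn', abs_mul,
      abs_of_nonneg (Real.sqrt_nonneg d)]
    calc |lam| * √d / n * |labelSum σ| ≤ √d * √d / n * (n / d) := by gcongr
      _ = 1 := by rw [Real.mul_self_sqrt hd.le]; field_simp
  exact add_le_add le_rfl (abs_le.1 h2).2

end Balance

/-! ### Transfer to the block model and diagonal extraction -/

/-- A property that is likely uniformly over sparse models with independent edges is likely in the
stochastic block model. -/
theorem UniformlyLikely.tendsto_sbm {d lam : ℝ} (hd : 1 ≤ d) (hlam : |lam| ≤ √d)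
    {E : ∀ n, SimpleGraph (Fin n) → Prop} (hE : UniformlyLikely (d + 1) (2 * d) E) :
    Tendsto (fun n => (sbm n d lam).real {G | E n G}) atTop (𝓝 1) := by
  have hlower : ∀ η > 0, ∀ᶠ n : ℕ in atTop, (1 - η) ≤ (sbm n d lam).real {G | E n G} := by
    intro η hη
    have hbal : ∀ᶠ n : ℕ in atTop, d ^ 2 / n ≤ η / 2 := by
      have h : Tendsto (fun n : ℕ => d ^ 2 / (n : ℝ)) atTop (𝓝 0) :=
        tendsto_const_div_atTop_nhds_zero_nat _
      filter_upwards [h.eventually (gt_mem_nhds (half_pos hη))] with n hn using hn.le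
    have hlarge : ∀ᶠ n : ℕ in atTop, 2 * d ≤ n :=
      tendsto_natCast_atTop_atTop.eventually_ge_atTop (2 * d)
    filter_upwards [hE (η / 2) (half_pos hη), hbal, hlarge, eventually_gt_atTop 0]
      with n h1 h2 h3 h4
    have hn' : (0 : ℝ) < n := by exact_mod_cast h4
    set Bal : Finset (Fin n → ℤˣ) := Finset.univ.filter fun σ => ¬ (n / d < |labelSum σ|) with hBal
    set Unb : Finset (Fin n → ℤˣ) := Finset.univ.filter fun σ => n / d < |labelSum σ| with hUnb
    have hcard : (Unb.card : ℝ) + Bal.card = 2 ^ n := by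
      have := Finset.card_filter_add_card_filter_not (s := (Finset.univ : Finset (Fin n → ℤˣ)))
        fun σ => n / d < |labelSum σ|
      rw [Finset.card_univ] at this
      simp only [Fintype.card_pi, Fintype.card_units_int, Finset.prod_const, Finset.card_univ,
        Fintype.card_fin] at this
      exact_mod_cast this
    have hUnb' : (Unb.card : ℝ) ≤ η / 2 * 2 ^ n := by
      have h5 := card_unbalanced_le (n := n) (a := n / d) (by positivity)
      have h6 : (Unb.card : ℝ) ≤ d ^ 2 / n * 2 ^ n := by
        rw [← hUnb] at h5
        have h7 : (0 : ℝ) < (n / d) ^ 2 := by positivity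
        rw [← le_div_iff₀ h7] at h5
        refine h5.trans (le_of_eq ?_)
        field_simp
      exact h6.trans (by gcongr)
    have hgiven : ∀ σ ∈ Bal, 1 - η / 2 ≤ (sbmGiven n d lam σ).real {G | E n G} := by
      intro σ hσ
      have hσ' : |labelSum σ| ≤ n / d := not_lt.1 (Finset.mem_filter.1 hσ).2
      have h5 := h1 (sbmEdgeProb n d lam σ)
        (sum_sbmEdgeProb_le (by linarith) hlam h3 h4 hσ')
        (sbmEdgeProb_le (by linarith) hlam h3 h4 σ)
      have h6 : (coinMeasure (sbmEdgeProb n d lam σ)).real {ω | E n (coinGraph ω)} ≤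
          (sbmGiven n d lam σ).real {G | E n G} := by
        refine ENNReal.toReal_mono (measure_ne_top _ _) ?_
        exact Measure.le_map_apply (measurable_of_finite _).aemeasurable _
      have h7 := probReal_compl_eq_one_sub (μ := coinMeasure (sbmEdgeProb n d lam σ))
        (measurableSet_coins {ω | E n (coinGraph ω)})
      have h8 : {ω : Sym2 (Fin n) → Prop | E n (coinGraph ω)}ᶜ = {ω | ¬ E n (coinGraph ω)} := rfl
      rw [h8] at h7
      linarith
    have hsbm : (sbm n d lam).real {G | E n G} =
        ((2 : ℝ) ^ n)⁻¹ * ∑ σ : Fin n → ℤˣ, (sbmGiven n d lam σ).real {G | E n G} := by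
      simp only [measureReal_def, sbm, Measure.smul_apply, Measure.finsetSum_apply, smul_eq_mul,
        ENNReal.toReal_mul, ENNReal.toReal_inv, ENNReal.toReal_pow, ENNReal.toReal_ofNat]
      rw [ENNReal.toReal_sum fun σ _ => measure_ne_top _ _]
    have hsum : (Bal.card : ℝ) * (1 - η / 2) ≤
        ∑ σ : Fin n → ℤˣ, (sbmGiven n d lam σ).real {G | E n G} := by
      rw [← nsmul_eq_mul, ← Finset.sum_const]
      exact (Finset.sum_le_sum hgiven).trans (Finset.sum_le_sum_of_subset_of_nonneg
        (Finset.subset_univ _) fun _ _ _ => measureReal_nonneg)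
    rw [hsbm, inv_mul_eq_div, le_div_iff₀ (by positivity)]
    have hB : (Bal.card : ℝ) ≤ 2 ^ n := by
      have : (0 : ℝ) ≤ Unb.card := by positivity
      linarith
    nlinarith
  rw [Metric.tendsto_atTop']
  intro η hη
  obtain ⟨N, hN⟩ := (hlower (η / 2) (half_pos hη)).exists_forall_of_atTop
  refine ⟨N, fun n hn => ?_⟩
  have h1 := hN n hn.le
  have h2 : (sbm n d lam).real {G | E n G} ≤ 1 := measureReal_le_one
  rw [Real.dist_eq, abs_lt]
  constructor <;> linarith

/-- Diagonal extraction: a family of statements that hold in the limit for every fixed `δ > 0`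
still holds along some `δ n → 0`. -/
theorem exists_tendsto_zero_of_forall_tendsto {F : ℕ → ℝ → ℝ} (hF1 : ∀ n δ, F n δ ≤ 1)
    (hF0 : ∀ n δ, 0 ≤ F n δ) (hF : ∀ δ > 0, Tendsto (fun n => F n δ) atTop (𝓝 1)) :
    ∃ δ : ℕ → ℝ, Tendsto δ atTop (𝓝 0) ∧ Tendsto (fun n => F n (δ n)) atTop (𝓝 1) := by
  classical
  set P : ℕ → ℕ → Prop := fun n m => 1 - 1 / ((m : ℝ) + 1) ≤ F n (1 / ((m : ℝ) + 1)) with hP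
  set k : ℕ → ℕ := fun n => Nat.findGreatest (P n) n with hk
  -- The search always succeeds, since `P n 0` only says that `F` is nonnegative.
  have hPk : ∀ n, P n (k n) := by
    intro n
    refine Nat.findGreatest_spec (P := P n) (Nat.zero_le n) ?_
    simpa [hP] using hF0 n _
  have hklim : Tendsto k atTop atTop := by
    rw [tendsto_atTop]
    intro m
    have hpos : (0 : ℝ) < 1 / ((m : ℝ) + 1) := by positivity
    filter_upwards [(hF _ hpos).eventually (lt_mem_nhds (sub_lt_self 1 hpos)),
      eventually_ge_atTop m] with n h1 h2
    exact Nat.le_findGreatest h2 h1.le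
  have hδ : Tendsto (fun n => 1 / ((k n : ℝ) + 1)) atTop (𝓝 0) :=
    tendsto_one_div_add_atTop_nhds_zero_nat.comp hklim
  refine ⟨fun n => 1 / ((k n : ℝ) + 1), hδ, ?_⟩
  refine tendsto_of_tendsto_of_tendsto_of_le_of_le (g := fun n => 1 - 1 / ((k n : ℝ) + 1)) ?_
    tendsto_const_nhds (fun n => hPk n) (fun n => hF1 n _)
  simpa using hδ.const_sub 1

/-! ### Choice of constants and conclusion -/

/-- The numerical content of the lower bound on `ε`. -/
theorem mul_sq_le_cube_of_le {d ε : ℝ} (hd : 1 ≤ d)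
    (hε : 10 ^ 6 * ((3 + Real.log d) / d) ^ (1 / 3 : ℝ) ≤ ε) :
    10 ^ 5 * (3 + Real.log d) * (d + ε * d) ^ 2 ≤ (ε * d) ^ 3 := by
  have hlog : 0 ≤ Real.log d := Real.log_nonneg hd
  set l : ℝ := 3 + Real.log d with hl
  have hl3 : 3 ≤ l := by linarith
  have hld : l ≤ 3 * d := by
    have := Real.log_le_sub_one_of_pos (by linarith : 0 < d)
    linarith
  have hd0 : 0 < d := by linarith
  have hε0 : 0 ≤ ε := le_trans (by positivity) hε
  set x : ℝ := ε * d with hx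
  have hx0 : 0 ≤ x := by positivity
  have hcube : 10 ^ 18 * (d ^ 2 * l) ≤ x ^ 3 := by
    have h1 : (10 ^ 6 * (l / d) ^ (1 / 3 : ℝ)) ^ 3 ≤ ε ^ 3 := by gcongr
    have h2 : ((l / d) ^ (1 / 3 : ℝ)) ^ 3 = l / d := by
      rw [← Real.rpow_natCast, ← Real.rpow_mul (by positivity)]; norm_num
    rw [mul_pow, h2] at h1
    have h3 := mul_le_mul_of_nonneg_right h1 (by positivity : 0 ≤ d ^ 3)
    calc (10 : ℝ) ^ 18 * (d ^ 2 * l) = (10 ^ 6) ^ 3 * (l / d) * d ^ 3 := by field_simp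
      _ ≤ ε ^ 3 * d ^ 3 := h3
      _ = x ^ 3 := by rw [hx]; ring
  -- `d + x` is comparable to the larger of `d` and `x`. When `x` dominates, a bound linear in `l`
  -- suffices, and it follows from the cubic one through `l ≤ 3 * d`.
  rcases le_total x d with h | h
  · have h1 : (d + x) ^ 2 ≤ 4 * d ^ 2 := by nlinarith
    calc 10 ^ 5 * l * (d + x) ^ 2 ≤ 10 ^ 5 * l * (4 * d ^ 2) := by gcongr
      _ ≤ 10 ^ 18 * (d ^ 2 * l) := by nlinarith [mul_nonneg (sq_nonneg d) (by linarith : 0 ≤ l)]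
      _ ≤ x ^ 3 := hcube
  · have h1 : (d + x) ^ 2 ≤ 4 * x ^ 2 := by nlinarith
    have h2 : 4 * 10 ^ 5 * l ≤ x := by
      refine le_of_pow_le_pow_left₀ three_ne_zero hx0 (le_trans ?_ hcube)
      have h3 : l ^ 2 ≤ 9 * d ^ 2 := by nlinarith
      have h4 := mul_le_mul_of_nonneg_right h3 (by linarith : 0 ≤ l)
      nlinarith [mul_nonneg (sq_nonneg d) (by linarith : 0 ≤ l)]
    calc 10 ^ 5 * l * (d + x) ^ 2 ≤ 10 ^ 5 * l * (4 * x ^ 2) := by gcongr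
      _ = (4 * 10 ^ 5 * l) * x ^ 2 := by ring
      _ ≤ x * x ^ 2 := by gcongr
      _ = x ^ 3 := by ring

/-- With relative slack `t = x / (d + x)`, the exponent `γ / T` is a constant multiple of `t² x = x³
/ (d + x)²`, which the hypothesis compares with the logarithm. -/
theorem uniformlyLikely_hasDecomposition_of_le {d x δ : ℝ} (c : ℝ) (hd : 1 ≤ d) (hx : 0 < x)
    (h : 10 ^ 5 * (3 + Real.log d) * (d + x) ^ 2 ≤ x ^ 3) (hδ : 0 < δ) :
    UniformlyLikely (d + 1) c fun n G => G.HasDecomposition (δ * Real.log n) (d + x) := by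
  have hlog : 0 ≤ Real.log d := Real.log_nonneg hd
  set l : ℝ := 3 + Real.log d with hl
  have hl3 : 3 ≤ l := by linarith
  have hy : 0 < d + x := by linarith
  have hx2 : 3 * 10 ^ 5 * (d + x) ≤ x ^ 2 := by
    have h1 : 3 * 10 ^ 5 * (d + x) * (d + x) ≤ x ^ 2 * (d + x) := by
      have h2 : 10 ^ 5 * 3 * (d + x) ^ 2 ≤ 10 ^ 5 * l * (d + x) ^ 2 := by gcongr
      have h3 : x ^ 3 ≤ x ^ 2 * (d + x) := by
        rw [pow_succ]; gcongr; linarith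
      nlinarith
    exact le_of_mul_le_mul_right h1 hy
  have hxbig : 3 * 10 ^ 5 ≤ x := by
    have : 3 * 10 ^ 5 * x ≤ x * x := by nlinarith
    exact le_of_mul_le_mul_right this hx
  set t : ℝ := x / (d + x) with ht
  have ht0 : 0 < t := by positivity
  have ht1 : t ≤ 1 := (div_le_one hy).2 (by linarith)
  have htx : t * (d + x) = x := by rw [ht]; field_simp
  have hq8 : 8 ≤ 4 * (d + 1) := by linarith
  have hlq : 0 < Real.log (4 * (d + 1)) := Real.log_pos (by linarith)
  have hlq' : Real.log (8 * (d + 1)) ≤ l := by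
    have h1 : Real.log (8 * (d + 1)) ≤ Real.log (16 * d) :=
      Real.log_le_log (by linarith) (by linarith)
    have h2 : Real.log 16 ≤ 3 := by
      have : Real.log 16 = 4 * Real.log 2 := by
        rw [show (16 : ℝ) = 2 ^ 4 by norm_num, Real.log_pow]; norm_num
      linarith [Real.log_two_lt_d9]
    have h3 : Real.log (16 * d) = Real.log 16 + Real.log d :=
      Real.log_mul (by norm_num) (by linarith)
    linarith
  have hlq4 : Real.log (4 * (d + 1)) ≤ l :=
    (Real.log_le_log (by linarith) (by linarith)).trans hlq'
  have hγT : t * x / 64 / (84 / t) = t ^ 2 * x / 5376 := by field_simp; norm_num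
  have hgain : 10 ^ 5 * l ≤ t ^ 2 * x := by
    have : t ^ 2 * x = x ^ 3 / (d + x) ^ 2 := by rw [ht]; field_simp
    rw [this, le_div_iff₀ (by positivity)]
    exact h
  -- `D₁` lies halfway between `d` and `D`. The choices give equality in three conditions: `θ T =
  -- 21`, `κ K = 2` and `4 K log (4q) = 1/2`.
  refine uniformlyLikely_hasDecomposition (D₁ := d + x / 2) (θ := t / 4) (T := 84 / t)
    (s := t / 16) (γ := t * x / 64) (κ := 16 * Real.log (4 * (d + 1)))
    (K := 1 / (8 * Real.log (4 * (d + 1)))) (by linarith) (by linarith) (by linarith)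
    (by positivity) (by linarith) ?_ ?_ (by positivity) (by positivity) ?_ (by positivity) ?_
    (by positivity) ?_ ?_ hδ
  · have h1 : Real.exp (2 * (t / 4)) * (1 - t / 2) ≤ 1 := by
      have h2 := Real.add_one_le_exp (-(t / 2))
      calc Real.exp (2 * (t / 4)) * (1 - t / 2)
          ≤ Real.exp (2 * (t / 4)) * Real.exp (-(t / 2)) := by gcongr; linarith
        _ = 1 := by rw [← Real.exp_add]; ring_nf; simp
    have h3 : d + x / 2 = (1 - t / 2) * (d + x) := by linarith
    calc (d + x / 2) * Real.exp (2 * (t / 4))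
        = Real.exp (2 * (t / 4)) * (1 - t / 2) * (d + x) := by rw [h3]; ring
      _ ≤ 1 * (d + x) := by gcongr
      _ = d + x := one_mul _
  · refine le_of_eq ?_
    field_simp
    norm_num
  -- To second order in `s` the gain is `s (x/2 - T - 1 - s (d + 1))`, and for this `s` the bracket
  -- is at least `x / 4`.
  · have hexp : Real.exp (t / 16) - 1 ≤ t / 16 + (t / 16) ^ 2 := by
      have h1 := Real.abs_exp_sub_one_sub_id_le (x := t / 16) (by
        rw [abs_of_nonneg (by positivity)]; linarith)
      linarith [(abs_le.1 h1).2]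
    have hT : 84 / t ≤ x / 1000 := by
      rw [div_le_iff₀ ht0, ht, ← mul_div_assoc, le_div_iff₀ hy]
      nlinarith
    have h1 := mul_le_mul_of_nonneg_right hexp (by linarith : 0 ≤ d + 1)
    have h2 : t / 16 * (d + 1) ≤ x / 8 := by nlinarith
    have h3 : t * x / 64 ≤ t / 16 * (x / 2 - x / 1000 - 1 - t / 16 * (d + 1)) := by
      have : x / 4 ≤ x / 2 - x / 1000 - 1 - t / 16 * (d + 1) := by linarith
      calc t * x / 64 = t / 16 * (x / 4) := by ring
        _ ≤ _ := by gcongr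
    have h4 := mul_le_mul_of_nonneg_left hT (by positivity : 0 ≤ t / 16)
    nlinarith
  -- The two logarithms contribute at most `17 * l`, while `10 ^ 5 / 5376 > 18`.
  · rw [hγT]
    have h1 : 8 * (d + 1) = Real.exp (Real.log (8 * (d + 1))) :=
      (Real.exp_log (by linarith)).symm
    rw [h1, ← Real.exp_add]
    refine Real.exp_le_exp.2 ?_
    linarith
  · refine le_of_eq ?_
    field_simp
    norm_num
  · refine le_of_eq ?_
    field_simp
    norm_num

theorem theorem3p6 :
    ∃ C₁ C₂ : ℝ, 0 < C₁ ∧ 0 < C₂ ∧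
      ∀ d lam : ℝ, 1 ≤ d → |lam| ≤ √d →
        ∀ ε : ℝ, C₁ * ((C₂ + Real.log d) / d) ^ (1 / 3 : ℝ) ≤ ε →
          ∃ Δ : ℕ → ℝ, (Δ =o[atTop] fun n : ℕ => Real.log n) ∧
            Tendsto
              (fun n : ℕ => sbm n d lam
                {G : SimpleGraph (Fin n) | ∃ G₁ G₂ : SimpleGraph (Fin n),
                  G₁.edgeSet ∪ G₂.edgeSet = G.edgeSet ∧ Disjoint G₁.edgeSet G₂.edgeSet ∧
                  (∀ v, ((G₁.neighborSet v).ncard : ℝ) ≤ (1 + ε) * d) ∧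
                  G₂.IsNearForest ∧
                  G₂.IsPseudorandom (Δ n) ((1 + ε) * d) (G₁.support ∩ G₂.support)})
              atTop (𝓝 1) := by
  refine ⟨10 ^ 6, 3, by norm_num, by norm_num, fun d lam hd hlam ε hε => ?_⟩
  have hlog : 0 ≤ Real.log d := Real.log_nonneg hd
  have hd0 : 0 < d := by linarith
  have hε0 : 0 < ε := lt_of_lt_of_le (by positivity) hε
  have hlikely : ∀ δ > 0, Tendsto (fun n : ℕ => (sbm n d lam).real
      {G | G.HasDecomposition (δ * Real.log n) (d + ε * d)}) atTop (𝓝 1) := fun δ hδ =>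
    (uniformlyLikely_hasDecomposition_of_le _ hd (by positivity)
      (mul_sq_le_cube_of_le hd hε) hδ).tendsto_sbm hd hlam
  -- Letting `δ` tend to 0 along `n` turns `δ log n` into a function that is `o(log n)`.
  obtain ⟨δ, hδ, hlim⟩ := exists_tendsto_zero_of_forall_tendsto
    (F := fun n δ => (sbm n d lam).real
      {G | G.HasDecomposition (δ * Real.log n) (d + ε * d)})
    (fun _ _ => measureReal_le_one) (fun _ _ => measureReal_nonneg) hlikely
  refine ⟨fun n => δ n * Real.log n, ?_, ?_⟩
  · have h1 : δ =o[atTop] fun _ : ℕ => (1 : ℝ) := (isLittleO_one_iff ℝ).2 hδ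
    simpa using h1.mul_isBigO (isBigO_refl (fun n : ℕ => Real.log n) atTop)
  · rw [show (1 + ε) * d = d + ε * d by ring]
    rw [← ENNReal.tendsto_toReal_iff (fun n => measure_ne_top _ _) ENNReal.one_ne_top]
    exact hlim
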